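/- **Setting.** For a finite set $T$ let $\Delta(T)$ be the simplex of distributions on $T$; the type of $v\in T^n$ is $\tau_v(a)=\frac1n|\{j: v(j)=a\}|$. An oblivious AVC consists of finite alphabets $\mathcal X,\mathcal S,\mathcal Y$, a closed convex set $\lambda_{\mathbf x}\subseteq\Delta(\mathcal X)$ (input constraints), a convex set $\lambda_{\mathbf s}\subseteq\Delta(\mathcal S)$ (state constraints) and a channel $W(y|x,s)$, used memorylessly: $W^{\otimes n}(y|x,s)=\prod_jW(y(j)|x(j),s(j))$. A code of blocklength $n$ with $M\ge1$ messages is an encoder $i\mapsto x_i\in\mathcal X^n$ with $\tau_{x_i}\in\lambda_{\mathbf x}$ for all $i\in[M]$, together with an $L$-list-decoder $\psi$, which maps each $y\in\mathcal Y^n$ to a set of at most $L$ messages; its rate is $\frac{\log M}{n\log|\mathcal X|}$. Put $$P_e(s)=\frac1M\sum_{i\in[M]}\ \sum_{y:\,i\notin\psi(y)}W^{\otimes n}(y|x_i,s),\qquad P_{e,\mathrm{avg}}=\max_{s\in\mathcal S^n:\ \tau_s\in\lambda_{\mathbf s}}P_e(s)$$ (the maximum over the empty set being $0$). A rate $R$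 is achievable if there are codes of strictly increasing blocklengths, each of rate at least $R$, with $P_{e,\mathrm{avg}}\to0$. The $L$-list-decoding capacity $C_L$ is the supremum of the achievable rates, and at least $0$. **Symmetrizability.** A conditional distribution $U(s|u,x_1,\dots,x_L)$, $u\in[k]$, is *$L$-symmetrizing* if for all $u,y$ and all $x_0,\dots,x_L$ the sum $\sum_sW(y|x_0,s)U(s|u,x_1,\dots,x_L)$ does not change when $(x_0,\dots,x_L)$ is permuted. A *cp-decomposition* of a distribution $Q$ on $\mathcal X^L$ is a pair $(P_u,P_{x|u})$ with $P_u\in\Delta([k])$ for some $k$, $P_{x|u}(\cdot|u)\in\Delta(\mathcal X)$ and $Q(x_1,\dots,x_L)=\sum_uP_u(u)\prod_iP_{x|u}(x_i|u)$; the distributions $Q$ that have one and whose one-dimensional marginals all equal $P_x$ form $\mathrm{cp}^{\otimes L}(P_x)$. For such a pair let $P_s(s)=\sum_{u,x_1,\dots,x_L}P_u(u)\prod_iP_{x|u}(x_i|u)\,U(s|u,x_1,\dots,x_L)$. The distribution $P_x\in\lambda_{\mathbf x}$ is *cp-$L$-symmetrizable* if for every $Q\in\mathrm{cp}^{\otimes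 L}(P_x)$ and every cp-decomposition of $Q$ there is an $L$-symmetrizing $U$ with $P_s\in\lambda_{\mathbf s}$. Let $L^*_{cp}(P_x)$ be the supremum of the $L\ge1$ for which $P_x$ is cp-$L$-symmetrizable ($0$ if there are none) and $L^*_{cp}=\inf_{P_x\in\lambda_{\mathbf x}}L^*_{cp}(P_x)$. **Theorem.** Let $1\le L\le L^*_{cp}$. Assume that $L$-symmetrization does not happen only on the boundary of the state constraints: for every $P_x\in\lambda_{\mathbf x}$ and every cp-decomposition of an element of $\mathrm{cp}^{\otimes L}(P_x)$, if some $L$-symmetrizing $U$ gives $P_s\in\lambda_{\mathbf s}$, then some $L$-symmetrizing $U$ gives a $P_s$ in the interior of $\lambda_{\mathbf s}$ relative to $\Delta(\mathcal S)$. Then $C_L=0$. Moreover there is a constant $c_1>0$, depending only on the AVC and $L$, such that for every $R>0$, all sufficiently large $n$, every $M$ and every encoder of blocklength $n$ with $M$ messages that satisfies the input constraints and has rate at least $R$, the following holds. There is a jamming law $q$ on $\{s\in\mathcal S^n:\tau_s\in\lambda_{\mathbf s}\}$, depending on the encoder but neither on the transmitted message nor on the decoder, such that every $L$-list-decoder satisfies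 $$\mathbb E_{s\sim q}[P_e(s)]\ge c_1,\qquad\text{and hence}\qquad P_{e,\mathrm{avg}}\ge c_1.$$ The law $q$ can be chosen to be a *cp-symmetrization*: for some sequence $u\in[k]^n$, some $L$-symmetrizing $U$ and some $s_0$ with $\tau_{s_0}\in\lambda_{\mathbf s}$, James draws messages $i_1<\dots<i_L$ uniformly from the $L$-subsets of $[M]$, draws $s(j)\sim U(\cdot|u(j),x_{i_1}(j),\dots,x_{i_L}(j))$ independently for $j=1,\dots,n$, and sends $s$ if $\tau_s\in\lambda_{\mathbf s}$ and $s_0$ otherwise. -/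

import Mathlib

open Filter Topology
open scoped ENNReal

noncomputable section

/-- The type (empirical distribution) of a vector `v` of length `n` over `T`. -/
def empType {T : Type*} [DecidableEq T] {n : ℕ} (v : Fin n → T) : T → ℝ :=
  fun a => ((Finset.univ.filter fun j => v j = a).card : ℝ) / n

/-- An oblivious AVC: finite alphabets `X`, `S`, `Y`, convex sets of admissible input and state
distributions (the set of input distributions being closed), and a channel `W(y|x,s)`. -/
structure ObliviousAVC (X S Y : Type*) [Fintype X] [Fintype S] [Fintype Y] where
  /-- input constraints -/
  inputSet : Set (X → ℝ)
  input_subset : inputSet ⊆ stdSimplex ℝ X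
  input_convex : Convex ℝ inputSet
  input_closed : IsClosed inputSet
  /-- state constraints -/
  stateSet : Set (S → ℝ)
  state_subset : stateSet ⊆ stdSimplex ℝ S
  state_convex : Convex ℝ stateSet
  /-- `W x s y` is the probability of the output `y` given the input `x` and the state `s` -/
  W : X → S → Y → ℝ
  W_mem : ∀ x s, W x s ∈ stdSimplex ℝ Y

/-- Self-couplings of order `L`: distributions on `X ^ L` all of whose marginals are `Px`. -/
def selfCouplings {X : Type*} [Fintype X] [DecidableEq X] (L : ℕ) (Px : X → ℝ) :
    Set ((Fin L → X) → ℝ) :=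
  {Q | Q ∈ stdSimplex ℝ (Fin L → X) ∧
    ∀ (i : Fin L) (a : X), ∑ x ∈ Finset.univ.filter (fun x : Fin L → X => x i = a), Q x = Px a}

/-- `(Pu, Pxu)`, with time-sharing alphabet `Fin k`, is a cp-decomposition of `Q`: the
distribution `Q` is the mixture `∑ u, Pu u • (Pxu u)^{⊗ L}`. -/
def IsCPDecomposition {X : Type*} [Fintype X] {L k : ℕ} (Pu : Fin k → ℝ)
    (Pxu : Fin k → X → ℝ) (Q : (Fin L → X) → ℝ) : Prop :=
  Pu ∈ stdSimplex ℝ (Fin k) ∧ (∀ u, Pxu u ∈ stdSimplex ℝ X) ∧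
    ∀ x, Q x = ∑ u, Pu u * ∏ i, Pxu u (x i)

/-- The completely positive self-couplings of `Px` of order `L`. -/
def cpDistributions {X : Type*} [Fintype X] [DecidableEq X] (L : ℕ) (Px : X → ℝ) :
    Set ((Fin L → X) → ℝ) :=
  {Q | Q ∈ selfCouplings L Px ∧
    ∃ (k : ℕ) (Pu : Fin k → ℝ) (Pxu : Fin k → X → ℝ), IsCPDecomposition Pu Pxu Q}

/-- The state distribution: the `s`-marginal of `Pu Pxu^{⊗ L} U`. -/
def jammingMarginal {X S : Type*} [Fintype X] {L k : ℕ} (Pu : Fin k → ℝ)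
    (Pxu : Fin k → X → ℝ) (U : Fin k → (Fin L → X) → S → ℝ) : S → ℝ :=
  fun s => ∑ u, ∑ x : Fin L → X, Pu u * (∏ i, Pxu u (x i)) * U u x s

/-- A list-decoder: any map from output sequences to
sets of at most `L` messages. -/
structure ListDecoder (Y : Type*) (L n M : ℕ) where
  dec : (Fin n → Y) → Finset (Fin M)
  card_le : ∀ y, (dec y).card ≤ L

namespace ObliviousAVC

variable {X S Y : Type*} [Fintype X] [Fintype S] [Fintype Y] [DecidableEq X] [DecidableEq S]

/-! ### Symmetrizability -/

/-- Conditional distributions `U(s | u, x_1, …, x_L)` that are obliviously `L`-symmetrizing: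
`∑ s, W(y|x_0,s) U(s|u,x_1,…,x_L)` is invariant under the permutations of `(x_0, …, x_L)`. -/
def symmetrizing (A : ObliviousAVC X S Y) (L k : ℕ) : Set (Fin k → (Fin L → X) → S → ℝ) :=
  {U | (∀ u x, U u x ∈ stdSimplex ℝ S) ∧
    ∀ (u : Fin k) (x : Fin (L + 1) → X) (y : Y) (π : Equiv.Perm (Fin (L + 1))),
      ∑ s, A.W (x 0) s y * U u (fun i => x i.succ) s =
        ∑ s, A.W (x (π 0)) s y * U u (fun i => x (π i.succ)) s}

/-- `Px` is obliviously cp-`L`-symmetrizable. -/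
def CPSymmetrizable (A : ObliviousAVC X S Y) (L : ℕ) (Px : X → ℝ) : Prop :=
  ∀ Q ∈ cpDistributions L Px, ∀ (k : ℕ) (Pu : Fin k → ℝ) (Pxu : Fin k → X → ℝ),
    IsCPDecomposition Pu Pxu Q →
      ∃ U ∈ A.symmetrizing L k, jammingMarginal Pu Pxu U ∈ A.stateSet

/-- The cp-symmetrizability `L*_cp(Px)` of an input distribution (`0` if there is no admissible
list size, `⊤` if there are arbitrarily large ones). -/
def LcpAt (A : ObliviousAVC X S Y) (Px : X → ℝ) : ℕ∞ :=
  ⨆ (L : ℕ) (_ : 1 ≤ L ∧ A.CPSymmetrizable L Px), (L : ℕ∞)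

/-- The cp-symmetrizability `L*_cp` of the channel. -/
def Lcp (A : ObliviousAVC X S Y) : ℕ∞ :=
  ⨅ Px ∈ A.inputSet, A.LcpAt Px

/-- The interior of the state constraints relative to the simplex of all state distributions. -/
def stateInterior (A : ObliviousAVC X S Y) : Set (S → ℝ) :=
  {P | P ∈ stdSimplex ℝ S ∧ A.stateSet ∈ 𝓝[stdSimplex ℝ S] P}

/-- Symmetrization at list size `L` never happens only on the boundary of the state constraints:
if a cp-decomposition can be symmetrized within the state constraints at all, then it can be
symmetrized in their interior. -/
def NoBoundarySymmetrization (A : ObliviousAVC X S Y) (L : ℕ) : Prop :=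
  ∀ Px ∈ A.inputSet, ∀ Q ∈ cpDistributions L Px,
    ∀ (k : ℕ) (Pu : Fin k → ℝ) (Pxu : Fin k → X → ℝ), IsCPDecomposition Pu Pxu Q →
      (∃ U ∈ A.symmetrizing L k, jammingMarginal Pu Pxu U ∈ A.stateSet) →
        ∃ U ∈ A.symmetrizing L k, jammingMarginal Pu Pxu U ∈ A.stateInterior

/-! ### Codes, error probability, capacity -/

/-- Encoders with `M` messages and blocklength `n` satisfying the input constraints. -/
structure Encoder (A : ObliviousAVC X S Y) (n M : ℕ) where
  enc : Fin M → Fin n → X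
  feasible : ∀ m, empType (enc m) ∈ A.inputSet

/-- State sequences that satisfy the state constraints. -/
def FeasibleState (A : ObliviousAVC X S Y) {n : ℕ} (s : Fin n → S) : Prop :=
  empType s ∈ A.stateSet

/-- The rate `log M / (n log |X|)` of a code with `M` messages and blocklength `n`. -/
def rate (_A : ObliviousAVC X S Y) (n M : ℕ) : ℝ :=
  Real.log M / (n * Real.log (Fintype.card X))

/-- The memoryless extension of the channel. -/
def Wn (A : ObliviousAVC X S Y) {n : ℕ} (x : Fin n → X) (s : Fin n → S) (y : Fin n → Y) : ℝ :=
  ∏ j, A.W (x j) (s j) (y j)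

/-- Probability of list-decoding error, averaged over the messages, when the state sequence
is `s`. -/
def avgErrorAt (A : ObliviousAVC X S Y) {L n M : ℕ} (φ : A.Encoder n M)
    (ψ : ListDecoder Y L n M) (s : Fin n → S) : ℝ :=
  (1 / (M : ℝ)) * ∑ i : Fin M,
    ∑ y ∈ Finset.univ.filter (fun y : Fin n → Y => i ∉ ψ.dec y), A.Wn (φ.enc i) s y

/-- The average probability of error of a code: the worst case over the feasible state
sequences. -/
def avgError (A : ObliviousAVC X S Y) {L n M : ℕ} (φ : A.Encoder n M)
    (ψ : ListDecoder Y L n M) : ℝ :=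
  ⨆ s : {s : Fin n → S // A.FeasibleState s}, A.avgErrorAt φ ψ s.1

/-- Rates achievable under `L`-list-decoding. -/
def Achievable (A : ObliviousAVC X S Y) (L : ℕ) (R : ℝ) : Prop :=
  ∃ (n M : ℕ → ℕ) (φ : ∀ t, A.Encoder (n t) (M t)) (ψ : ∀ t, ListDecoder Y L (n t) (M t)),
    StrictMono n ∧ (∀ t, 0 < n t ∧ 0 < M t ∧ R ≤ A.rate (n t) (M t)) ∧
      Tendsto (fun t => A.avgError (φ t) (ψ t)) atTop (𝓝 0)

/-- The `L`-list-decoding capacity: the supremum of the achievable rates (`0` if there are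
none). -/
def capacity (A : ObliviousAVC X S Y) (L : ℕ) : ℝ≥0∞ :=
  ⨆ (R : ℝ) (_ : A.Achievable L R), ENNReal.ofReal R

/-! ### Jamming -/

/-- A (random) jamming strategy for blocklength `n`: a law on the feasible state sequences. -/
def IsJammingLaw (A : ObliviousAVC X S Y) {n : ℕ} (q : (Fin n → S) → ℝ) : Prop :=
  q ∈ stdSimplex ℝ (Fin n → S) ∧ ∀ s, q s ≠ 0 → A.FeasibleState s

/-- The law of the sequence obtained as follows: draw a uniformly random set of `L` messages,
listed in ascending order, and pass their codewords letter by letter through the memoryless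
channel `U(s | u, x_1, …, x_L)`, where `u` follows the time-sharing sequence. -/
def spoofedLaw (A : ObliviousAVC X S Y) {L n M k : ℕ} (φ : A.Encoder n M) (u : Fin n → Fin k)
    (U : Fin k → (Fin L → X) → S → ℝ) : (Fin n → S) → ℝ :=
  fun s => (1 / (M.choose L : ℝ)) *
    ∑ l : Fin L ↪o Fin M, ∏ j, U (u j) (fun i => φ.enc (l i) j) (s j)

open Classical in
/-- `q` is a cp-symmetrization attack with list size `L` against the code `φ`: draw a state
sequence from `spoofedLaw` for some time-sharing sequence and some symmetrizing `U`; if it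
violates the state constraints, send a fixed feasible sequence `s₀` instead. -/
def IsCPSymmetrization (A : ObliviousAVC X S Y) (L : ℕ) {n M : ℕ} (φ : A.Encoder n M)
    (q : (Fin n → S) → ℝ) : Prop :=
  ∃ (k : ℕ) (u : Fin n → Fin k), ∃ U ∈ A.symmetrizing L k, ∃ s₀ : Fin n → S,
    A.FeasibleState s₀ ∧
      ∀ s, q s = (if A.FeasibleState s then A.spoofedLaw φ u U s else 0) +
        if s = s₀ then
          ∑ s' ∈ Finset.univ.filter (fun s' => ¬ A.FeasibleState s'), A.spoofedLaw φ u U s'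
        else 0

end ObliviousAVC

end

/-! James imitates codewords. When the jamming channel is symmetrizing, the output law is the same
whichever of `L + 1` messages is sent while the other `L` are spoofed. A list of size `L` misses one
of the `L + 1`, so the `L + 1` error probabilities sum to at least `1`
(`one_le_sum_wordLaw_mul_errorProb`). The difficulty is the state constraint: the spoofed sequence
must have an admissible type for a constant fraction of the choices of messages, for an arbitrary
code of positive rate.

For this a subcode `B` of constant density is extracted on which sums of single-letter functions
concentrate. Codewords are embedded as unit vectors, and one maximizes `|A| * exp (K * ‖mean of A‖ ^
2)` over the subcodes `A`. If `A` varied too much in some direction, one of the two halves cut out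
by that direction would lose only a constant factor in size but have a mean of larger norm,
contradicting maximality (`exists_subset_small_weakVariation`). Replacing codewords by letter
frequencies one at a time, and adding a variance bound for the channel noise, shows that for most
`L`-tuples from `B` the type of the spoofed sequence is close to the state marginal of a
cp-decomposition (`sum_tuples_deviation_le`): time-sharing is uniform over the `n` positions, and
the conditional law at a position is the letter frequency of `B` there. By convexity the resulting
input distribution is admissible, so it can be symmetrized.

The distance of that marginal from the boundary must not depend on `n`, although the time-sharing
alphabet grows with `n`. For a fixed alphabet size, compactness puts the marginals in a polytope
inside the relative interior. A Carathéodory argument reduces arbitrary alphabets to sizes at most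
`|X|` (`exists_symmetrizing_margin`).

The subcode enters only the choice of `U` and the analysis; the spoofed messages are drawn from the
whole code. With probability bounded below, all `L + 1` messages involved lie in `B`, which yields
`c₁`. The rate matters only in making the number of messages large. -/

noncomputable section

/-! ### Subsets of vectors with small weak variation -/

section WeakVariation

variable {ι E : Type*} [NormedAddCommGroup E] [InnerProductSpace ℝ E]

/-- The mean of the vectors `z i`, `i ∈ A`. -/
def finsetMean (A : Finset ι) (z : ι → E) : E := (A.card : ℝ)⁻¹ • ∑ i ∈ A, z i

lemma card_smul_finsetMean {A : Finset ι} (hA : A.Nonempty) (z : ι → E) :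
    (A.card : ℝ) • finsetMean A z = ∑ i ∈ A, z i := by
  have : (A.card : ℝ) ≠ 0 := by exact_mod_cast hA.card_pos.ne'
  rw [finsetMean, smul_inv_smul₀ this]

lemma norm_finsetMean_le {A : Finset ι} {z : ι → E} (hz : ∀ i, ‖z i‖ ≤ 1) :
    ‖finsetMean A z‖ ≤ 1 := by
  rw [finsetMean, norm_smul, norm_inv, Real.norm_natCast]
  have h : ‖∑ i ∈ A, z i‖ ≤ A.card := by
    refine (norm_sum_le _ _).trans ((Finset.sum_le_sum fun i _ => hz i).trans (by simp))
  exact inv_mul_le_one_of_le₀ h (by positivity)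

/-- The defect in the convexity of the squared norm is explicit: if a set is split into parts with
distant means, the weighted average of their squared norms exceeds that of the whole by this defect.
-/
lemma norm_sq_convexComb (x y : E) (a b : ℝ) (hab : a + b = 1) :
    ‖a • x + b • y‖ ^ 2 = a * ‖x‖ ^ 2 + b * ‖y‖ ^ 2 - a * b * ‖x - y‖ ^ 2 := by
  obtain rfl : b = 1 - a := by linarith
  rw [norm_add_sq_real, norm_sub_sq_real, norm_smul, norm_smul, inner_smul_left,
    inner_smul_right, mul_pow, mul_pow, Real.norm_eq_abs, Real.norm_eq_abs, sq_abs, sq_abs]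
  simp only [conj_trivial]
  ring

/-- If the vectors `z i`, `i ∈ A`, vary in the direction `v`, then a subset that is not too small
has a mean of larger norm. -/
lemma exists_subset_mean_increment [DecidableEq ι] {z : ι → E} (hz : ∀ i, ‖z i‖ ≤ 1) {ε : ℝ}
    (hε : 0 < ε) {A : Finset ι} (hA : A.Nonempty) {v : E} (hv : ‖v‖ ≤ 1)
    (hvar : ε * A.card < ∑ i ∈ A, |inner ℝ v (z i - finsetMean A z)|) :
    ∃ B ⊆ A, B.Nonempty ∧ ε / 4 * A.card ≤ B.card ∧
      ‖finsetMean A z‖ ^ 2 + ε ^ 4 / 16 ≤ ‖finsetMean B z‖ ^ 2 := by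
  set m := finsetMean A z with hm
  set h : ι → ℝ := fun i => inner ℝ v (z i - m) with hh
  have hA0 : (0 : ℝ) < A.card := by exact_mod_cast hA.card_pos
  have hh2 : ∀ i, |h i| ≤ 2 := fun i => by
    refine (abs_real_inner_le_norm _ _).trans ?_
    have h1 : ‖z i - m‖ ≤ 2 := (norm_sub_le _ _).trans (by
      have := hz i; have := norm_finsetMean_le (A := A) hz; linarith)
    nlinarith [norm_nonneg v, norm_nonneg (z i - m)]
  have hsum : ∑ i ∈ A, h i = 0 := by
    simp only [hh]
    rw [← inner_sum, Finset.sum_sub_distrib, ← card_smul_finsetMean hA]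
    simp [hm, Nat.cast_smul_eq_nsmul]
  -- The `h i` sum to zero, so the positive and the nonpositive ones each carry half of the absolute
  -- sum. As `|h i| ≤ 2`, both parts have at least `ε / 4 * |A|` elements.
  set B := A.filter fun i => 0 < h i with hB
  set C := A.filter fun i => ¬ 0 < h i with hC
  have hsplit : ∀ f : ι → ℝ, ∑ i ∈ B, f i + ∑ i ∈ C, f i = ∑ i ∈ A, f i :=
    fun f => Finset.sum_filter_add_sum_filter_not _ _ _
  have hBabs : ∑ i ∈ B, |h i| = ∑ i ∈ B, h i :=
    Finset.sum_congr rfl fun i hi => abs_of_pos (Finset.mem_filter.1 hi).2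
  have hCabs : ∑ i ∈ C, |h i| = - ∑ i ∈ C, h i := by
    rw [← Finset.sum_neg_distrib]
    exact Finset.sum_congr rfl fun i hi => abs_of_nonpos (not_lt.1 (Finset.mem_filter.1 hi).2)
  have h1 := hsplit h
  have h2 := hsplit fun i => |h i|
  have hBs : ε / 2 * A.card < ∑ i ∈ B, h i := by linarith
  have hCs : ∑ i ∈ C, h i < - (ε / 2 * A.card) := by linarith
  have hbound : ∀ D : Finset ι, ∑ i ∈ D, |h i| ≤ 2 * D.card := fun D =>
    (Finset.sum_le_sum fun i _ => hh2 i).trans (by simp [mul_comm])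
  have hBc : ε / 4 * A.card ≤ B.card := by linarith [hbound B]
  have hCc : ε / 4 * A.card ≤ C.card := by linarith [hbound C]
  have hB0 : (0 : ℝ) < B.card := lt_of_lt_of_le (by positivity) hBc
  have hC0 : (0 : ℝ) < C.card := lt_of_lt_of_le (by positivity) hCc
  have hBn : B.Nonempty := by rw [← Finset.card_pos]; exact_mod_cast hB0
  have hCn : C.Nonempty := by rw [← Finset.card_pos]; exact_mod_cast hC0
  have hcard : (B.card : ℝ) + C.card = A.card := by
    simpa using hsplit fun _ => (1 : ℝ)
  have hinner : ∀ D : Finset ι, D.Nonempty →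
      D.card * inner ℝ v (finsetMean D z - m) = ∑ i ∈ D, h i := fun D hD => by
    simp only [hh]
    rw [← inner_sum, Finset.sum_sub_distrib, ← card_smul_finsetMean hD, Finset.sum_const,
      ← Nat.cast_smul_eq_nsmul ℝ, ← smul_sub, inner_smul_right]
  have hvB : ε / 2 < inner ℝ v (finsetMean B z - m) := by
    have h3 := hinner B hBn
    have h4 : (B.card : ℝ) ≤ A.card := by linarith
    by_contra! hcon
    nlinarith
  have hvC : inner ℝ v (finsetMean C z - m) < - (ε / 2) := by
    have h3 := hinner C hCn
    have h4 : (C.card : ℝ) ≤ A.card := by linarith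
    by_contra! hcon
    nlinarith
  have hdist : ε ≤ ‖finsetMean B z - finsetMean C z‖ := by
    have h5 : inner ℝ v (finsetMean B z - finsetMean C z) =
        inner ℝ v (finsetMean B z - m) - inner ℝ v (finsetMean C z - m) := by
      rw [← inner_sub_right]; congr 1; abel
    have h6 := (le_abs_self _).trans
      (abs_real_inner_le_norm v (finsetMean B z - finsetMean C z))
    nlinarith [norm_nonneg v, norm_nonneg (finsetMean B z - finsetMean C z)]
  set β : ℝ := B.card / A.card with hβ
  set γ : ℝ := C.card / A.card with hγ
  have hβγ : β + γ = 1 := by rw [hβ, hγ, ← add_div, hcard, div_self hA0.ne']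
  have hβ4 : ε / 4 ≤ β := by rw [hβ, le_div_iff₀ hA0]; exact hBc
  have hγ4 : ε / 4 ≤ γ := by rw [hγ, le_div_iff₀ hA0]; exact hCc
  have hmBC : m = β • finsetMean B z + γ • finsetMean C z := by
    have : (A.card : ℝ) • m =
        (A.card : ℝ) • (β • finsetMean B z + γ • finsetMean C z) := by
      rw [smul_add, smul_smul, smul_smul, hβ, hγ, mul_div_cancel₀ _ hA0.ne',
        mul_div_cancel₀ _ hA0.ne', card_smul_finsetMean hA, card_smul_finsetMean hBn,
        card_smul_finsetMean hCn]
      exact (Finset.sum_filter_add_sum_filter_not _ _ _).symm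
    exact smul_right_injective E hA0.ne' this
  have hid := norm_sq_convexComb (finsetMean B z) (finsetMean C z) β γ hβγ
  rw [← hmBC] at hid
  have hgain : ε ^ 4 / 16 ≤ β * γ * ‖finsetMean B z - finsetMean C z‖ ^ 2 := by
    have e1 : ε / 4 * (ε / 4) ≤ β * γ :=
      mul_le_mul hβ4 hγ4 (by positivity) (by linarith)
    have e2 : ε ^ 2 ≤ ‖finsetMean B z - finsetMean C z‖ ^ 2 :=
      pow_le_pow_left₀ hε.le hdist 2
    have e3 := mul_le_mul e1 e2 (by positivity) (by nlinarith)
    calc ε ^ 4 / 16 = ε / 4 * (ε / 4) * ε ^ 2 := by ring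
      _ ≤ _ := e3
  -- The weighted average of the two squared norms is at least the required bound, so one of the two
  -- parts reaches it.
  by_cases hcase : ‖m‖ ^ 2 + ε ^ 4 / 16 ≤ ‖finsetMean B z‖ ^ 2
  · exact ⟨B, Finset.filter_subset _ _, hBn, hBc, hcase⟩
  · refine ⟨C, Finset.filter_subset _ _, hCn, hCc, ?_⟩
    by_contra hcase'
    push Not at hcase hcase'
    have hβ0 : 0 < β := by linarith
    have hγ0 : 0 < γ := by linarith
    nlinarith [mul_lt_mul_of_pos_left hcase hβ0, mul_lt_mul_of_pos_left hcase' hγ0]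

/-- A finite family of vectors in the unit ball has a subfamily, of a density that depends on `ε`
only, whose variation in every direction is at most `ε`. -/
theorem exists_subset_small_weakVariation {ε : ℝ} (hε : 0 < ε) :
    ∃ α : ℝ, 0 < α ∧ ∀ {ι E : Type*} [Fintype ι] [Nonempty ι] [NormedAddCommGroup E]
      [InnerProductSpace ℝ E] (z : ι → E), (∀ i, ‖z i‖ ≤ 1) →
      ∃ A : Finset ι, A.Nonempty ∧ α * Fintype.card ι ≤ A.card ∧
        ∀ v : E, ‖v‖ ≤ 1 →
          ∑ i ∈ A, |inner ℝ v (z i - finsetMean A z)| ≤ ε * A.card := by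
  -- `K` is so large that the gain in the exponent from one increment outweighs the loss of a factor
  -- `ε / 4` in cardinality.
  obtain ⟨K, hK0, hK⟩ : ∃ K : ℝ, 0 ≤ K ∧ 1 < ε / 4 * Real.exp (K * (ε ^ 4 / 16)) := by
    have ht : Tendsto (fun K : ℝ => ε / 4 * Real.exp (K * (ε ^ 4 / 16))) atTop atTop :=
      (Real.tendsto_exp_atTop.comp
        (tendsto_id.atTop_mul_const (by positivity))).const_mul_atTop (by positivity)
    obtain ⟨K, h1, h2⟩ := ((eventually_ge_atTop 0).and (ht.eventually_gt_atTop 1)).exists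
    exact ⟨K, h1, h2⟩
  refine ⟨Real.exp (-K), Real.exp_pos _, fun {ι E} _ _ _ _ z hz => ?_⟩
  classical
  set Φ : Finset ι → ℝ := fun A => A.card * Real.exp (K * ‖finsetMean A z‖ ^ 2) with hΦ
  obtain ⟨A, hA, hmax⟩ := Finset.exists_max_image
    (Finset.univ.filter fun A : Finset ι => A.Nonempty) Φ
    ⟨Finset.univ, by simp⟩
  replace hA : A.Nonempty := (Finset.mem_filter.1 hA).2
  refine ⟨A, hA, ?_, fun v hv => ?_⟩
  · have h1 := hmax Finset.univ (by simp)
    simp only [hΦ, Finset.card_univ] at h1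
    have h2 : Real.exp (K * ‖finsetMean A z‖ ^ 2) ≤ Real.exp K := by
      apply Real.exp_le_exp.2
      have := norm_finsetMean_le (A := A) hz
      have : ‖finsetMean A z‖ ^ 2 ≤ 1 := pow_le_one₀ (norm_nonneg _) this
      nlinarith
    have h3 : (1 : ℝ) ≤ Real.exp (K * ‖finsetMean Finset.univ z‖ ^ 2) :=
      Real.one_le_exp (by positivity)
    have h4 : (Fintype.card ι : ℝ) ≤ A.card * Real.exp K := by
      calc (Fintype.card ι : ℝ) ≤ Fintype.card ι * Real.exp (K * ‖finsetMean Finset.univ z‖ ^ 2) :=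
            le_mul_of_one_le_right (by positivity) h3
        _ ≤ _ := h1
        _ ≤ _ := by gcongr
    rw [Real.exp_neg, inv_mul_le_iff₀ (Real.exp_pos _)]
    linarith
  · by_contra! hcon
    obtain ⟨B, -, hBn, hBc, hinc⟩ := exists_subset_mean_increment hz hε hA hv hcon
    have h1 := hmax B (by simp [hBn])
    simp only [hΦ] at h1
    have hA0 : (0 : ℝ) < A.card := by exact_mod_cast hA.card_pos
    have h2 : A.card * Real.exp (K * ‖finsetMean A z‖ ^ 2) <
        B.card * Real.exp (K * ‖finsetMean B z‖ ^ 2) := by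
      calc A.card * Real.exp (K * ‖finsetMean A z‖ ^ 2)
          < (ε / 4 * Real.exp (K * (ε ^ 4 / 16))) *
              (A.card * Real.exp (K * ‖finsetMean A z‖ ^ 2)) :=
            lt_mul_of_one_lt_left (by positivity) hK
        _ = (ε / 4 * A.card) * Real.exp (K * (‖finsetMean A z‖ ^ 2 + ε ^ 4 / 16)) := by
            rw [mul_add, Real.exp_add]; ring
        _ ≤ _ := by gcongr
    linarith

end WeakVariation

/-! ### Averages over tuples of codewords -/

/-- The relative frequency of the letter `a` among the letters `c i`. -/
def letterFreq {ι T : Type*} [Fintype ι] [DecidableEq T] (c : ι → T) (a : T) : ℝ :=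
  (Fintype.card ι : ℝ)⁻¹ * ∑ i, if c i = a then 1 else 0

section LetterFreq

variable {ι T : Type*} [Fintype ι] [Fintype T] [DecidableEq T]

lemma sum_letterFreq_mul (c : ι → T) (g : T → ℝ) :
    ∑ a, letterFreq c a * g a = (Fintype.card ι : ℝ)⁻¹ * ∑ i, g (c i) := by
  simp only [letterFreq, mul_assoc, ← Finset.mul_sum, Finset.sum_mul]
  rw [Finset.sum_comm]
  simp

lemma letterFreq_mem_stdSimplex [Nonempty ι] (c : ι → T) : letterFreq c ∈ stdSimplex ℝ T := by
  refine ⟨fun a => ?_, ?_⟩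
  · unfold letterFreq
    have : (0 : ℝ) ≤ ∑ i, if c i = a then 1 else 0 :=
      Finset.sum_nonneg fun i _ => by split_ifs <;> norm_num
    positivity
  · have := sum_letterFreq_mul c fun _ => 1
    simpa using this

end LetterFreq

lemma sum_prod_stdSimplex {ι T : Type*} [Fintype ι] [DecidableEq ι] [Fintype T] {p : ι → T → ℝ}
    (hp : ∀ i, p i ∈ stdSimplex ℝ T) : ∑ y : ι → T, ∏ i, p i (y i) = 1 := by
  have := Fintype.prod_sum p
  rw [← this]
  exact Finset.prod_eq_one fun i _ => (hp i).2

lemma sum_fin_succ_fun {T M : Type*} [Fintype T] [AddCommMonoid M] {n : ℕ}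
    (f : (Fin (n + 1) → T) → M) :
    ∑ y, f y = ∑ a, ∑ y : Fin n → T, f (Fin.cons a y : Fin (n + 1) → T) := by
  rw [← (Fin.consEquiv fun _ : Fin (n + 1) => T).sum_comp, Fintype.sum_prod_type]
  rfl

/-- If the code `x` has small variation in every direction, then a function of `L` codewords that
is a sum over the positions is, for most `L`-tuples of codewords, close to its value at the
product of the letter frequencies. -/
lemma sum_tuples_abs_sub_le {ι T : Type*} [Fintype ι] [Nonempty ι] [Fintype T] [DecidableEq T]
    {n : ℕ} (x : ι → Fin n → T) {η : ℝ}
    (hreg : ∀ f : Fin n → T → ℝ, (∀ j a, f j a ∈ Set.Icc (0 : ℝ) 1) →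
      ∑ i, |∑ j, (f j (x i j) - ∑ a, letterFreq (fun i => x i j) a * f j a)| ≤
        η * Fintype.card ι) (L : ℕ) (f : Fin n → (Fin L → T) → ℝ)
    (hf : ∀ j y, f j y ∈ Set.Icc (0 : ℝ) 1) :
    ∑ t : Fin L → ι, |∑ j, (f j (fun l => x (t l) j) -
      ∑ y : Fin L → T, (∏ l, letterFreq (fun i => x i j) (y l)) * f j y)| ≤
        L * η * (Fintype.card ι : ℝ) ^ L := by
  induction L with
  | zero => simp [Subsingleton.elim _ (default : Fin 0 → T)]
  | succ L ih =>
    set p : Fin n → T → ℝ := fun j => letterFreq fun i => x i j with hp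
    have hpm : ∀ j, p j ∈ stdSimplex ℝ T := fun j => letterFreq_mem_stdSimplex _
    -- Hybrid argument: `g` averages out all inputs but the first. The induction hypothesis replaces
    -- the other `L` codewords with the first one fixed, and `hreg` applied to `g` then replaces the
    -- first.
    set g : Fin n → T → ℝ := fun j a =>
      ∑ y : Fin L → T, (∏ l, p j (y l)) * f j (Fin.cons a y : Fin (L + 1) → T) with hg
    have hgm : ∀ j a, g j a ∈ Set.Icc (0 : ℝ) 1 := fun j a => by
      refine ⟨Finset.sum_nonneg fun y _ => mul_nonneg
        (Finset.prod_nonneg fun l _ => (hpm j).1 _) (hf _ _).1, ?_⟩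
      rw [← sum_prod_stdSimplex fun _ : Fin L => hpm j]
      exact Finset.sum_le_sum fun y _ => mul_le_of_le_one_right
        (Finset.prod_nonneg fun l _ => (hpm j).1 _) (hf _ _).2
    have hgp : ∀ j, ∑ y : Fin (L + 1) → T, (∏ l, letterFreq (fun i => x i j) (y l)) * f j y =
        ∑ a, p j a * g j a := fun j => by
        rw [sum_fin_succ_fun]
        refine Finset.sum_congr rfl fun a _ => ?_
        rw [hg, Finset.mul_sum]
        refine Finset.sum_congr rfl fun y _ => ?_
        rw [Fin.prod_univ_succ]
        simp [mul_assoc, hp]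
    rw [sum_fin_succ_fun]
    simp only [hgp]
    have hcons : ∀ (i : ι) (t : Fin L → ι) (j : Fin n),
        (fun l => x ((Fin.cons i t : Fin (L + 1) → ι) l) j) =
          (Fin.cons (x i j) fun l => x (t l) j : Fin (L + 1) → T) := fun i t j => by
      funext l
      refine Fin.cases ?_ (fun l => ?_) l <;> simp
    simp only [hcons]
    have hstep : ∀ i, ∑ t : Fin L → ι, |∑ j, (f j (Fin.cons (x i j) fun l => x (t l) j) -
        ∑ a, p j a * g j a)| ≤ L * η * (Fintype.card ι : ℝ) ^ L +
          (Fintype.card ι : ℝ) ^ L * |∑ j, (g j (x i j) - ∑ a, p j a * g j a)| := fun i => by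
      have h1 := ih (fun j y => f j (Fin.cons (x i j) y)) fun j y => hf _ _
      have h2 : ∑ _t : Fin L → ι, |∑ j, (g j (x i j) - ∑ a, p j a * g j a)| =
          (Fintype.card ι : ℝ) ^ L * |∑ j, (g j (x i j) - ∑ a, p j a * g j a)| := by
        simp
      rw [← h2]
      refine le_trans ?_ (add_le_add h1 le_rfl)
      rw [← Finset.sum_add_distrib]
      refine Finset.sum_le_sum fun t _ => ?_
      refine le_trans (le_of_eq ?_) (abs_add_le _ _)
      rw [← Finset.sum_add_distrib]
      congr 1
      exact Finset.sum_congr rfl fun j _ => by simp only [hg, hp]; ring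
    refine (Finset.sum_le_sum fun i _ => hstep i).trans ?_
    rw [Finset.sum_add_distrib]
    have h3 := mul_le_mul_of_nonneg_left (hreg g hgm)
      (by positivity : (0 : ℝ) ≤ (Fintype.card ι : ℝ) ^ L)
    rw [Finset.mul_sum] at h3
    refine (add_le_add le_rfl h3).trans (le_of_eq ?_)
    simp only [Finset.sum_const, Finset.card_univ, nsmul_eq_mul]
    push_cast
    ring

/-- The variance of a sum of independent centered variables with values in `[-1, 1]`. -/
lemma sum_prod_mul_sq_le {S : Type*} [Fintype S] {n : ℕ} (p : Fin n → S → ℝ)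
    (hp : ∀ j, p j ∈ stdSimplex ℝ S) (f : Fin n → S → ℝ) (hf : ∀ j b, |f j b| ≤ 1)
    (h0 : ∀ j, ∑ b, p j b * f j b = 0) :
    ∑ s : Fin n → S, (∏ j, p j (s j)) * (∑ j, f j (s j)) ^ 2 ≤ n := by
  induction n with
  | zero => simp
  | succ n ih =>
    have h1 := ih (fun j => p j.succ) (fun j => hp _) (fun j => f j.succ) (fun j => hf _)
      fun j => h0 _
    have h2 := sum_prod_stdSimplex fun j : Fin n => hp j.succ
    rw [sum_fin_succ_fun]
    simp only [Fin.prod_univ_succ, Fin.sum_univ_succ, Fin.cons_zero, Fin.cons_succ]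
    -- In the expanded square the cross term vanishes because the first variable is centered.
    have hexp : ∀ b (s : Fin n → S), p 0 b * (∏ j : Fin n, p j.succ (s j)) *
        (f 0 b + ∑ j : Fin n, f j.succ (s j)) ^ 2 =
        (p 0 b * f 0 b ^ 2) * (∏ j : Fin n, p j.succ (s j)) +
        (p 0 b * f 0 b) * (2 * ((∏ j : Fin n, p j.succ (s j)) * ∑ j : Fin n, f j.succ (s j))) +
        p 0 b * ((∏ j : Fin n, p j.succ (s j)) * (∑ j : Fin n, f j.succ (s j)) ^ 2) :=
      fun b s => by ring
    simp only [hexp, Finset.sum_add_distrib, ← Finset.mul_sum, ← Finset.sum_mul, h0, h2, (hp 0).2]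
    have h3 : ∑ b, p 0 b * f 0 b ^ 2 ≤ 1 := by
      rw [← (hp 0).2]
      exact Finset.sum_le_sum fun b _ => mul_le_of_le_one_right ((hp 0).1 b)
        ((sq_le_one_iff_abs_le_one _).2 (hf 0 b))
    push_cast
    linarith

/-- Every code has a subcode, of a density that depends on `η` and the alphabet only, on which
every sum of functions of the single letters deviates little from its mean. -/
theorem exists_subcode_small_variation (T : Type*) [Fintype T] [DecidableEq T] {η : ℝ}
    (hη : 0 < η) :
    ∃ α : ℝ, 0 < α ∧ ∀ {M n : ℕ}, 0 < M → 0 < n → ∀ x : Fin M → Fin n → T,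
      ∃ A : Finset (Fin M), A.Nonempty ∧ α * M ≤ A.card ∧
        ∀ f : Fin n → T → ℝ, (∀ j a, f j a ∈ Set.Icc (0 : ℝ) 1) →
          ∑ i : A, |∑ j, (f j (x i j) - ∑ a, letterFreq (fun i : A => x i j) a * f j a)| ≤
            η * n * Fintype.card A := by
  -- The summand `1` keeps `D` positive for an empty alphabet.
  set D : ℝ := Fintype.card T + 1 with hD
  have hD0 : 0 < D := by positivity
  obtain ⟨α, hα, h⟩ := exists_subset_small_weakVariation (ε := η / D) (by positivity)
  refine ⟨α, hα, fun {M n} hM hn x => ?_⟩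
  have hn0 : (0 : ℝ) < n := by exact_mod_cast hn
  have hsq : √(n : ℝ) ^ 2 = n := Real.sq_sqrt hn0.le
  have hsq0 : 0 < √(n : ℝ) := Real.sqrt_pos.2 hn0
  have : Nonempty (Fin M) := ⟨⟨0, hM⟩⟩
  set z : Fin M → EuclideanSpace ℝ (Fin n × T) := fun i =>
    WithLp.toLp 2 fun ja => (if x i ja.1 = ja.2 then 1 else 0) / √(n : ℝ) with hz
  have hz1 : ∀ i, ‖z i‖ ≤ 1 := fun i => by
    rw [← abs_of_nonneg (norm_nonneg (z i)), ← sq_le_one_iff_abs_le_one,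
      EuclideanSpace.real_norm_sq_eq]
    simp [hz, Fintype.sum_prod_type, hsq, hn0.ne', ite_pow, ite_div]
  obtain ⟨A, hA, hcard, hvar⟩ := h z hz1
  refine ⟨A, hA, by simpa using hcard, fun f hf => ?_⟩
  have : Nonempty A := hA.to_subtype
  have hA0 : (0 : ℝ) < A.card := by exact_mod_cast hA.card_pos
  -- With these normalizations the inner product of `v` with the vector of a codeword is the sum of
  -- `f` along it divided by `n * D`, so a weak variation of `η / D` becomes `η * n`.
  set v : EuclideanSpace ℝ (Fin n × T) :=
    WithLp.toLp 2 fun ja => f ja.1 ja.2 / (√(n : ℝ) * D) with hv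
  have hv1 : ‖v‖ ≤ 1 := by
    rw [← abs_of_nonneg (norm_nonneg v), ← sq_le_one_iff_abs_le_one,
      EuclideanSpace.real_norm_sq_eq]
    have : ∀ ja ∈ (Finset.univ : Finset (Fin n × T)), v ja ^ 2 ≤ 1 / (n * D ^ 2) := by
      intro ja _
      simp only [hv, div_pow, mul_pow, hsq]
      have := hf ja.1 ja.2
      gcongr
      exact pow_le_one₀ this.1 this.2
    refine (Finset.sum_le_sum this).trans ?_
    simp only [Finset.sum_const, Finset.card_univ, Fintype.card_prod, Fintype.card_fin,
      nsmul_eq_mul, Nat.cast_mul]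
    rw [mul_one_div, div_le_one (by positivity)]
    have : (0 : ℝ) ≤ Fintype.card T := by positivity
    gcongr
    rw [hD]; nlinarith
  have hin : ∀ i, inner ℝ v (z i) = (∑ j, f j (x i j)) / (n * D) := fun i => by
    simp only [hv, hz, PiLp.inner_apply, RCLike.inner_apply, conj_trivial, Fintype.sum_prod_type,
      Finset.sum_div]
    refine Finset.sum_congr rfl fun j _ => ?_
    rw [Finset.sum_eq_single (x i j) (fun a _ ha => by simp [ha.symm]) (by simp)]
    simp only [if_true]
    field_simp
    rw [hsq, mul_comm]
  have hmean : inner ℝ v (finsetMean A z) =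
      (∑ j, ∑ a, letterFreq (fun i : A => x i j) a * f j a) / (n * D) := by
    simp only [sum_letterFreq_mul (fun i : A => x i _)]
    rw [finsetMean, inner_smul_right, inner_sum, ← Finset.mul_sum, Finset.sum_comm]
    simp only [hin, ← Finset.sum_div]
    rw [Finset.sum_coe_sort A fun i => ∑ j, f j (x i j), Fintype.card_coe, mul_div_assoc]
  have h1 := hvar v hv1
  have h2 : ∀ i, |∑ j, (f j (x i j) - ∑ a, letterFreq (fun i : A => x i j) a * f j a)| =
      n * D * |inner ℝ v (z i - finsetMean A z)| := fun i => by
    rw [inner_sub_right, hin, hmean, ← sub_div, abs_div, abs_of_pos (by positivity : 0 < n * D),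
      mul_div_cancel₀ _ (by positivity), Finset.sum_sub_distrib]
  simp only [h2]
  rw [← Finset.mul_sum, Finset.sum_coe_sort A fun i => |inner ℝ v (z i - finsetMean A z)|,
    Fintype.card_coe]
  calc _ ≤ n * D * (η / D * A.card) := by gcongr
    _ = _ := by field_simp

/-- Most `L`-tuples of codewords, passed through a memoryless channel `U`, lead to sequences in
which the number of occurrences of `b` is close to its mean for the product of the letter
frequencies. -/
lemma sum_tuples_deviation_le {ι T S : Type*} [Fintype ι] [Nonempty ι] [Fintype T] [DecidableEq T]
    [Fintype S] [DecidableEq S] {n L : ℕ} (hn : 0 < n) (x : ι → Fin n → T) {η θ : ℝ} (hθ : 0 < θ)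
    (hreg : ∀ f : Fin n → T → ℝ, (∀ j a, f j a ∈ Set.Icc (0 : ℝ) 1) →
      ∑ i, |∑ j, (f j (x i j) - ∑ a, letterFreq (fun i => x i j) a * f j a)| ≤
        η * n * Fintype.card ι) (U : Fin n → (Fin L → T) → S → ℝ)
    (hU : ∀ j y, U j y ∈ stdSimplex ℝ S) (b : S) :
    ∑ t : Fin L → ι, ∑ s : Fin n → S, (∏ j, U j (fun l => x (t l) j) (s j)) *
      |∑ j, ((if s j = b then 1 else 0) -
        ∑ y : Fin L → T, (∏ l, letterFreq (fun i => x i j) (y l)) * U j y b)| ≤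
      (1 / θ + θ * n + L * η * n) * (Fintype.card ι : ℝ) ^ L := by
  have hn0 : (0 : ℝ) < n := by exact_mod_cast hn
  have hle1 : ∀ j y b, U j y b ≤ 1 := fun j y b => by
    rw [← (hU j y).2]
    exact Finset.single_le_sum (fun b _ => (hU j y).1 b) (Finset.mem_univ b)
  have h1 := sum_tuples_abs_sub_le x hreg L (fun j y => U j y b)
    fun j y => ⟨(hU j y).1 b, hle1 j y b⟩
  set μ : Fin n → ℝ := fun j =>
    ∑ y : Fin L → T, (∏ l, letterFreq (fun i => x i j) (y l)) * U j y b with hμ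
  have h2 : ∀ t : Fin L → ι, ∑ s : Fin n → S, (∏ j, U j (fun l => x (t l) j) (s j)) *
      |∑ j, ((if s j = b then 1 else 0) - μ j)| ≤
      1 / θ + θ * n + |∑ j, (U j (fun l => x (t l) j) b - μ j)| := fun t => by
    set p : Fin n → S → ℝ := fun j => U j fun l => x (t l) j with hp
    have hpm : ∀ j, p j ∈ stdSimplex ℝ S := fun j => hU _ _
    have hvar := sum_prod_mul_sq_le p hpm (fun j c => (if c = b then 1 else 0) - p j b)
      (fun j c => by
        have := (hpm j).1 b
        have : p j b ≤ 1 := hle1 _ _ _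
        rw [abs_le]; split_ifs <;> constructor <;> linarith)
      (fun j => by simp [mul_sub, Finset.sum_sub_distrib, ← Finset.sum_mul, (hpm j).2])
    have hone := sum_prod_stdSimplex hpm
    have hpt : ∀ s : Fin n → S, (∏ j, p j (s j)) * |∑ j, ((if s j = b then 1 else 0) - μ j)| ≤
        1 / (θ * n) * ((∏ j, p j (s j)) * (∑ j, ((if s j = b then 1 else 0) - p j b)) ^ 2) +
        (∏ j, p j (s j)) * (θ * n + |∑ j, (p j b - μ j)|) := fun s => by
      have hpos : 0 ≤ ∏ j, p j (s j) := Finset.prod_nonneg fun j _ => (hpm j).1 _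
      set r : ℝ := ∑ j, ((if s j = b then 1 else 0) - p j b) with hr
      have e1 : ∑ j, ((if s j = b then 1 else 0) - μ j) = r + ∑ j, (p j b - μ j) := by
        rw [hr, ← Finset.sum_add_distrib]
        exact Finset.sum_congr rfl fun j _ => by ring
      -- Chebyshev in additive form: summed against the law of `s`, the quadratic term costs at most
      -- `1 / θ`, since the variance is at most `n`.
      have e2 : |r| ≤ 1 / (θ * n) * r ^ 2 + θ * n := by
        have hc : 0 < θ * n := by positivity
        set c := θ * n
        have : |r| * c ≤ r ^ 2 + c ^ 2 := by
          rw [← sq_abs r]; nlinarith [sq_nonneg (|r| - c), sq_nonneg |r|, sq_nonneg c]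
        rw [one_div, inv_mul_eq_div, ← sub_le_iff_le_add, le_div_iff₀ hc]
        nlinarith
      rw [e1]
      calc (∏ j, p j (s j)) * |r + ∑ j, (p j b - μ j)|
          ≤ (∏ j, p j (s j)) * ((1 / (θ * n) * r ^ 2 + θ * n) + |∑ j, (p j b - μ j)|) := by
            gcongr
            exact (abs_add_le _ _).trans (by gcongr)
        _ = _ := by ring
    refine (Finset.sum_le_sum fun s _ => hpt s).trans ?_
    rw [Finset.sum_add_distrib, ← Finset.mul_sum, ← Finset.sum_mul, hone, one_mul]
    have : 1 / (θ * n) * (∑ s : Fin n → S,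
        (∏ j, p j (s j)) * (∑ j, ((if s j = b then 1 else 0) - p j b)) ^ 2) ≤ 1 / θ := by
      calc _ ≤ 1 / (θ * n) * n := by gcongr
        _ = 1 / θ := by field_simp
    linarith
  refine (Finset.sum_le_sum fun t _ => h2 t).trans ?_
  rw [Finset.sum_add_distrib]
  refine (add_le_add le_rfl h1).trans (le_of_eq ?_)
  simp only [Finset.sum_const, Finset.card_univ, Fintype.card_fun, Fintype.card_fin, nsmul_eq_mul]
  push_cast
  ring

/-! ### Neighbourhoods in the simplex -/

section Simplex

variable {S : Type*} [Fintype S]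

/-- The homothetic copies of the simplex with centre `P` are neighbourhoods of `P` in it. -/
lemma image_homothety_stdSimplex_mem_nhdsWithin {P : S → ℝ} (hP : P ∈ stdSimplex ℝ S) {ρ : ℝ}
    (hρ : 0 < ρ) :
    (fun Q => (1 - ρ) • P + ρ • Q) '' stdSimplex ℝ S ∈ 𝓝[stdSimplex ℝ S] P := by
  have h1 : ∀ᶠ P' in 𝓝[stdSimplex ℝ S] P, ∀ b, (1 - ρ) * P b ≤ P' b := by
    rw [eventually_all]
    intro b
    -- At a zero coordinate of `P` nonnegativity suffices; at a positive one the bound is strict at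
    -- `P` and persists nearby.
    rcases (hP.1 b).eq_or_lt with h | h
    · filter_upwards [self_mem_nhdsWithin] with P' hP'
      rw [← h, mul_zero]
      exact hP'.1 b
    · have hc : Tendsto (fun P' : S → ℝ => P' b) (𝓝[stdSimplex ℝ S] P) (𝓝 (P b)) :=
        (continuous_apply b).continuousAt.tendsto.mono_left nhdsWithin_le_nhds
      exact (hc.eventually_const_lt (by nlinarith : (1 - ρ) * P b < P b)).mono fun _ h => h.le
  filter_upwards [h1, self_mem_nhdsWithin] with P' hP' hmem
  refine ⟨ρ⁻¹ • (P' - (1 - ρ) • P), ⟨fun b => ?_, ?_⟩, ?_⟩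
  · have := hP' b
    simp only [Pi.smul_apply, Pi.sub_apply, smul_eq_mul]
    exact mul_nonneg (inv_nonneg.2 hρ.le) (by linarith)
  · simp only [Pi.smul_apply, Pi.sub_apply, smul_eq_mul]
    rw [← Finset.mul_sum, Finset.sum_sub_distrib, ← Finset.mul_sum, hmem.2, hP.2]
    field_simp
    ring
  · simp only [smul_inv_smul₀ hρ.ne']
    abel

lemma eventually_homothety_stdSimplex_subset {P : S → ℝ} (hP : P ∈ stdSimplex ℝ S)
    {C : Set (S → ℝ)} (hC : C ∈ 𝓝[stdSimplex ℝ S] P) :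
    ∀ᶠ ρ : ℝ in 𝓝[>] 0, ∀ Q ∈ stdSimplex ℝ S, (1 - ρ) • P + ρ • Q ∈ C := by
  obtain ⟨δ, hδ, hsub⟩ := Metric.mem_nhdsWithin_iff.1 hC
  filter_upwards [Ioo_mem_nhdsGT (lt_min hδ one_pos)] with ρ hρ
  have hρ1 := hρ.2.trans_le (min_le_right _ _)
  refine fun Q hQ => hsub ⟨?_, ?_⟩
  · rw [Metric.mem_ball, dist_eq_norm]
    refine lt_of_le_of_lt ?_ (hρ.2.trans_le (min_le_left _ _))
    rw [pi_norm_le_iff_of_nonneg hρ.1.le]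
    intro b
    have hle : ∀ R ∈ stdSimplex ℝ S, R b ≤ 1 := fun R hR => by
      rw [← hR.2]
      exact Finset.single_le_sum (fun b _ => hR.1 b) (Finset.mem_univ b)
    have e : ((1 - ρ) • P + ρ • Q - P) b = ρ * (Q b - P b) := by
      simp only [Pi.add_apply, Pi.sub_apply, Pi.smul_apply, smul_eq_mul]; ring
    rw [e, norm_mul, Real.norm_of_nonneg hρ.1.le]
    refine mul_le_of_le_one_right hρ.1.le ?_
    rw [Real.norm_eq_abs, abs_le]
    constructor <;> linarith [hle Q hQ, hle P hP, hQ.1 b, hP.1 b]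
  · exact convex_stdSimplex ℝ S hP hQ (by linarith) hρ.1.le (by ring)

/-- A point is relatively interior exactly when `C` contains a small homothetic copy of the simplex
centred at it, and the copy at a convex combination is contained in the convex combination of the
copies of the same ratio at the two points. -/
lemma convex_interior_stdSimplex {C : Set (S → ℝ)} (hC : Convex ℝ C) :
    Convex ℝ {P | P ∈ stdSimplex ℝ S ∧ C ∈ 𝓝[stdSimplex ℝ S] P} := by
  rintro P ⟨hP, hPC⟩ Q ⟨hQ, hQC⟩ a b ha hb hab
  have hmem := convex_stdSimplex ℝ S hP hQ ha hb hab
  refine ⟨hmem, ?_⟩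
  obtain ⟨ρ, ⟨h1, h2⟩, hρ⟩ :=
    (((eventually_homothety_stdSimplex_subset hP hPC).and
      (eventually_homothety_stdSimplex_subset hQ hQC)).and self_mem_nhdsWithin).exists
  refine mem_of_superset (image_homothety_stdSimplex_mem_nhdsWithin hmem hρ) ?_
  rintro _ ⟨R, hR, rfl⟩
  have e : (1 - ρ) • (a • P + b • Q) + ρ • R =
      a • ((1 - ρ) • P + ρ • R) + b • ((1 - ρ) • Q + ρ • R) := by
    have : R = (a + b) • R := by rw [hab, one_smul]
    conv_lhs => rw [this]
    module
  show (1 - ρ) • (a • P + b • Q) + ρ • R ∈ C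
  rw [e]
  exact hC (h1 R hR) (h2 R hR) ha hb hab

/-- A point of the relative interior of `C` has a neighbourhood in the simplex that is a polytope
with vertices in the relative interior. -/
lemma exists_finite_convexHull_mem_nhdsWithin {C : Set (S → ℝ)} {P : S → ℝ}
    (hP : P ∈ stdSimplex ℝ S) (hPC : C ∈ 𝓝[stdSimplex ℝ S] P) :
    ∃ F : Set (S → ℝ), F.Finite ∧
      F ⊆ {P | P ∈ stdSimplex ℝ S ∧ C ∈ 𝓝[stdSimplex ℝ S] P} ∧
      convexHull ℝ F ∈ 𝓝[stdSimplex ℝ S] P := by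
  classical
  have hI : {P | P ∈ stdSimplex ℝ S ∧ C ∈ 𝓝[stdSimplex ℝ S] P} ∈ 𝓝[stdSimplex ℝ S] P :=
    (eventually_mem_nhdsWithin.and (eventually_eventually_nhdsWithin.2 hPC))
  obtain ⟨ρ, h, hρ⟩ :=
    ((eventually_homothety_stdSimplex_subset hP hI).and self_mem_nhdsWithin).exists
  refine ⟨Set.range fun b : S => (1 - ρ) • P + ρ • Pi.single b 1, Set.finite_range _, ?_, ?_⟩
  · rintro _ ⟨b, rfl⟩
    exact h _ (single_mem_stdSimplex ℝ b)
  · refine mem_of_superset (image_homothety_stdSimplex_mem_nhdsWithin hP hρ) ?_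
    rintro _ ⟨Q, hQ, rfl⟩
    have e : (1 - ρ) • P + ρ • Q = ∑ b, Q b • ((1 - ρ) • P + ρ • Pi.single b (1 : ℝ)) := by
      simp only [smul_add, Finset.sum_add_distrib, ← Finset.sum_smul, hQ.2, one_smul]
      congr 1
      simp only [smul_comm _ ρ, ← Finset.smul_sum]
      congr 1
      ext c
      simp [Finset.sum_apply, Pi.single_apply]
    show (1 - ρ) • P + ρ • Q ∈ _
    rw [e]
    exact (convex_convexHull ℝ _).sum_mem (fun b _ => hQ.1 b) hQ.2
      fun b _ => subset_convexHull ℝ _ ⟨b, rfl⟩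

/-- The convex hull of finitely many points of the relative interior of `C` has a positive
distance from the complement of `C` in the simplex. -/
lemma exists_margin_convexHull {C F : Set (S → ℝ)} (hC : Convex ℝ C) (hF : F.Finite)
    (hFC : F ⊆ {P | P ∈ stdSimplex ℝ S ∧ C ∈ 𝓝[stdSimplex ℝ S] P}) :
    ∃ δ : ℝ, 0 < δ ∧ ∀ P ∈ convexHull ℝ F, ∀ P' ∈ stdSimplex ℝ S,
      (∀ b, |P' b - P b| < δ) → P' ∈ C := by
  -- Relative neighbourhoods become open sets of the ambient space once all points outside the
  -- simplex are added; the compact hull then has a uniform thickening inside.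
  have hsub : convexHull ℝ F ⊆ interior {P | P ∈ stdSimplex ℝ S → P ∈ C} := fun P hP =>
    mem_interior_iff_mem_nhds.2 (mem_inf_principal.1
      (convexHull_min hFC (convex_interior_stdSimplex hC) hP).2)
  obtain ⟨δ, hδ, hthick⟩ :=
    (hF.isCompact_convexHull ℝ).exists_thickening_subset_open isOpen_interior hsub
  refine ⟨δ, hδ, fun P hP P' hP' hclose => interior_subset (hthick ?_) hP'⟩
  exact Metric.mem_thickening_iff.2 ⟨P, hP, (dist_pi_lt_iff hδ).2 fun b => by
    rw [Real.dist_eq]; exact hclose b⟩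

end Simplex

/-! ### Reduction of the support -/

section Caratheodory

variable {ι X V : Type*} [Fintype ι] [Fintype X] [AddCommGroup V] [Module ℝ V]

/-- Moving a nonnegative weight in a direction with a negative coordinate until its support
shrinks. -/
lemma exists_add_smul_support_ssubset {w c : ι → ℝ} (hw : ∀ j, 0 ≤ w j)
    (hsupp : ∀ j, w j = 0 → c j = 0) (hneg : ∃ j, c j < 0) :
    ∃ t : ℝ, 0 < t ∧ (∀ j, 0 ≤ w j + t * c j) ∧
      (Finset.univ.filter fun j => w j + t * c j ≠ 0).card <
        (Finset.univ.filter fun j => w j ≠ 0).card := by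
  -- Ratio test: `j₀` is the first coordinate to reach zero.
  obtain ⟨j₀, hj₀, hmin⟩ := Finset.exists_min_image (Finset.univ.filter fun j => c j < 0)
    (fun j => w j / -c j) (by obtain ⟨j, hj⟩ := hneg; exact ⟨j, by simpa using hj⟩)
  replace hj₀ : c j₀ < 0 := (Finset.mem_filter.1 hj₀).2
  have hw₀ : 0 < w j₀ := (hw j₀).lt_of_ne fun h => hj₀.ne (hsupp j₀ h.symm)
  have ht : 0 < w j₀ / -c j₀ := div_pos hw₀ (by linarith)
  refine ⟨w j₀ / -c j₀, ht, fun j => ?_, ?_⟩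
  · rcases lt_or_ge (c j) 0 with h | h
    · have h1 := hmin j (by simpa using h)
      rw [le_div_iff₀ (by linarith)] at h1
      linarith
    · have := hw j
      positivity
  · refine Finset.card_lt_card ((Finset.ssubset_iff_of_subset ?_).2 ⟨j₀, ?_, ?_⟩)
    · intro j hj
      simp only [Finset.mem_filter, Finset.mem_univ, true_and] at hj ⊢
      intro h
      exact hj (by rw [h, hsupp j h]; ring)
    · simpa using hw₀.ne'
    · simp only [Finset.mem_filter, Finset.mem_univ, true_and, not_not]
      have := hj₀.ne
      field_simp
      ring

/-- A property of the mixtures `∑ j, w j • v j`, `v j ∈ K j`, that is convex in `w` holds for all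
mixtures with a given barycenter if it holds for those whose support is at most as large as the
alphabet. -/
lemma exists_mixture_mem_of_small_support {p : ι → X → ℝ} (hp : ∀ j, p j ∈ stdSimplex ℝ X)
    {K : ι → Set V} (hK : ∀ j, Convex ℝ (K j)) {H : Set V} (hH : Convex ℝ H) {B : X → ℝ}
    (hsmall : ∀ w ∈ stdSimplex ℝ ι, ∑ j, w j • p j = B →
      (Finset.univ.filter fun j => w j ≠ 0).card ≤ Fintype.card X →
      ∃ v : ι → V, (∀ j, v j ∈ K j) ∧ ∑ j, w j • v j ∈ H)
    {w : ι → ℝ} (hw : w ∈ stdSimplex ℝ ι) (hB : ∑ j, w j • p j = B) :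
    ∃ v : ι → V, (∀ j, v j ∈ K j) ∧ ∑ j, w j • v j ∈ H := by
  induction hN : (Finset.univ.filter fun j => w j ≠ 0).card using Nat.strong_induction_on
    generalizing w with
  | _ N ih =>
  subst hN
  rcases le_or_gt (Finset.univ.filter fun j => w j ≠ 0).card (Fintype.card X) with hle | hlt
  · exact hsmall w hw hB hle
  -- More than `|X|` vectors in `ℝ ^ X` are dependent. Moving `w` along the relation `c` keeps the
  -- barycenter, and also the total mass because each `p j` has mass `1`.
  obtain ⟨c, hcsupp, hcp, hc0⟩ : ∃ c : ι → ℝ, (∀ j, w j = 0 → c j = 0) ∧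
      ∑ j, c j • p j = 0 ∧ ∃ j, c j ≠ 0 := by
    have hdep : ¬ LinearIndependent ℝ fun j : {j // w j ≠ 0} => p j := fun hli => by
      have := hli.fintype_card_le_finrank
      rw [Module.finrank_fintype_fun_eq_card, Fintype.card_subtype] at this
      omega
    obtain ⟨g, hg, j₀, hj₀⟩ := Fintype.not_linearIndependent_iff.1 hdep
    refine ⟨fun j => if h : w j ≠ 0 then g ⟨j, h⟩ else 0, fun j h => by simp [h], ?_,
      j₀, by simpa [j₀.2] using hj₀⟩
    rw [← hg, ← Finset.sum_filter_add_sum_filter_not Finset.univ (fun j => w j ≠ 0),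
      Finset.sum_eq_zero (s := Finset.univ.filter fun j => ¬ w j ≠ 0), add_zero,
      ← Finset.sum_subtype_eq_sum_filter]
    · rw [← Finset.subtype_univ]
      refine Finset.sum_congr (by ext; simp) fun j _ => ?_
      simp [j.2]
    · intro j hj
      have := (Finset.mem_filter.1 hj).2
      simp only [dif_neg this, zero_smul]
  have hcsum : ∑ j, c j = 0 := by
    have h1 : ∑ a, (∑ j, c j • p j) a = 0 := by rw [hcp]; simp
    simp only [Finset.sum_apply, Pi.smul_apply, smul_eq_mul] at h1
    rw [Finset.sum_comm] at h1
    simpa [← Finset.mul_sum, (hp _).2] using h1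
  obtain ⟨j₁, hj₁⟩ := hc0
  have hex : ∀ d : ι → ℝ, ∑ j, d j = 0 → (∃ j, d j ≠ 0) → ∃ j, d j < 0 := by
    intro d hd hd0
    by_contra! hcon
    obtain ⟨j, hj⟩ := hd0
    exact hj ((Finset.sum_eq_zero_iff_of_nonneg fun j _ => hcon j).1 hd j (Finset.mem_univ j))
  have key : ∀ d : ι → ℝ, ∑ j, d j = 0 → (∃ j, d j ≠ 0) → (∀ j, w j = 0 → d j = 0) →
      ∑ j, d j • p j = 0 → ∃ t : ℝ, 0 < t ∧ (∀ j, 0 ≤ w j + t * d j) ∧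
        ∃ v : ι → V, (∀ j, v j ∈ K j) ∧ ∑ j, (w j + t * d j) • v j ∈ H := by
    intro d hd hd0 hds hdp
    obtain ⟨t, ht, hnn, hcard⟩ := exists_add_smul_support_ssubset hw.1 hds (hex d hd hd0)
    refine ⟨t, ht, hnn, ih _ hcard ⟨hnn, ?_⟩ ?_ rfl⟩
    · rw [Finset.sum_add_distrib, ← Finset.mul_sum, hd, hw.2]; ring
    · simp only [add_smul, mul_smul, Finset.sum_add_distrib, ← Finset.smul_sum, hdp, hB]
      simp
  -- Unlike in the usual Carathéodory theorem, the claim is about `w` itself. Hence both directions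
  -- `c` and `-c` are followed, and `w` is recovered as a convex combination of the two endpoints,
  -- of smaller support; convexity of `K j` merges the two choices at `j`.
  obtain ⟨t, ht, hnn, v, hv, hvH⟩ := key c hcsum ⟨j₁, hj₁⟩ hcsupp hcp
  obtain ⟨r, hr, hnn', v', hv', hvH'⟩ := key (fun j => -c j) (by simp [hcsum])
    ⟨j₁, by simpa using hj₁⟩ (fun j h => by simp [hcsupp j h]) (by simp [hcp])
  have htr : 0 < t + r := by positivity
  have hcomb : ∀ j, ∃ u ∈ K j, w j • u =
      (r / (t + r) * (w j + t * c j)) • v j + (t / (t + r) * (w j + r * -c j)) • v' j := by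
    intro j
    obtain ⟨u, hu, hu'⟩ := (hK j).exists_mem_add_smul_eq (hv j) (hv' j)
      (mul_nonneg (by positivity) (hnn j) : 0 ≤ r / (t + r) * (w j + t * c j))
      (mul_nonneg (by positivity) (hnn' j) : 0 ≤ t / (t + r) * (w j + r * -c j))
    refine ⟨u, hu, ?_⟩
    rw [← hu']
    congr 1
    field_simp
    ring
  choose u hu hu' using hcomb
  refine ⟨u, hu, ?_⟩
  simp only [hu', Finset.sum_add_distrib, mul_smul, ← Finset.smul_sum]
  exact hH hvH hvH' (by positivity) (by positivity) (by field_simp; ring)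

end Caratheodory

lemma sum_equivFin_support_smul {ι V : Type*} [Fintype ι] [AddCommGroup V] [Module ℝ V]
    (w : ι → ℝ) (f : ι → V) :
    ∑ i, w ((Finset.univ.filter fun j => w j ≠ 0).equivFin.symm i) •
      f ((Finset.univ.filter fun j => w j ≠ 0).equivFin.symm i) = ∑ j, w j • f j := by
  rw [Equiv.sum_comp _ fun j : Finset.univ.filter fun j => w j ≠ 0 => w j • f j,
    Finset.sum_coe_sort _ fun j => w j • f j, Finset.sum_filter_of_ne]
  intro j _ hj h0
  exact hj (by rw [h0, zero_smul])

/-! ### Completely positive distributions -/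

lemma sum_filter_prod_eq {X : Type*} [Fintype X] [DecidableEq X] {L : ℕ} {p : X → ℝ}
    (hp : p ∈ stdSimplex ℝ X) (i : Fin L) (a : X) :
    ∑ x ∈ Finset.univ.filter (fun x : Fin L → X => x i = a), ∏ l, p (x l) = p a := by
  have h := Fintype.prod_sum fun (l : Fin L) b => p b * if l = i then (if b = a then 1 else 0) else 1
  have h1 : ∀ x : Fin L → X, ∏ l, (p (x l) * if l = i then (if x l = a then 1 else 0) else 1) =
      if x i = a then ∏ l, p (x l) else 0 := fun x => by
    rw [Finset.prod_mul_distrib, Finset.prod_ite_eq' Finset.univ i]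
    simp
  simp only [h1, ← Finset.sum_filter] at h
  rw [← h, Finset.prod_eq_single i (fun l _ hl => by simp [hl, hp.2]) (by simp)]
  simp

lemma mixture_mem_cpDistributions {X : Type*} [Fintype X] [DecidableEq X] {k : ℕ} (L : ℕ)
    {Pu : Fin k → ℝ} {Pxu : Fin k → X → ℝ} (hPu : Pu ∈ stdSimplex ℝ (Fin k))
    (hPxu : ∀ u, Pxu u ∈ stdSimplex ℝ X) :
    (fun x : Fin L → X => ∑ u, Pu u * ∏ i, Pxu u (x i)) ∈
      cpDistributions L (∑ u, Pu u • Pxu u) := by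
  refine ⟨⟨⟨fun x => ?_, ?_⟩, fun i a => ?_⟩, k, Pu, Pxu, hPu, hPxu, fun _ => rfl⟩
  · exact Finset.sum_nonneg fun u _ => mul_nonneg (hPu.1 u)
      (Finset.prod_nonneg fun i _ => (hPxu u).1 _)
  · rw [Finset.sum_comm]
    simp only [← Finset.mul_sum, sum_prod_stdSimplex fun _ : Fin L => hPxu _, mul_one, hPu.2]
  · rw [Finset.sum_comm]
    simp only [← Finset.mul_sum, sum_filter_prod_eq (hPxu _) i a]
    simp

/-- The law of the state when the inputs of `U` are independent with law `p`. -/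
def kernelMarginal {X S : Type*} [Fintype X] (L : ℕ) (p : X → ℝ) : ((Fin L → X) → S → ℝ) →ₗ[ℝ] (S → ℝ) where
  toFun U := ∑ x, (∏ i, p (x i)) • U x
  map_add' U V := by simp [Finset.sum_add_distrib]
  map_smul' c U := by simp [Finset.smul_sum, smul_comm c]

lemma jammingMarginal_eq {X S : Type*} [Fintype X] {L k : ℕ} (Pu : Fin k → ℝ) (Pxu : Fin k → X → ℝ)
    (U : Fin k → (Fin L → X) → S → ℝ) :
    jammingMarginal Pu Pxu U = ∑ u, Pu u • kernelMarginal L (Pxu u) (U u) := by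
  ext s
  simp [jammingMarginal, kernelMarginal, Finset.sum_apply, Finset.mul_sum, mul_assoc]

/-! ### Symmetrizing kernels and smaller list sizes -/

namespace ObliviousAVC

variable {X S Y : Type*} [Fintype X] [Fintype S] [Fintype Y]

/-- The conditional distributions `U(s | x_1, …, x_L)` that are `L`-symmetrizing. -/
def symmetrizingKernels (A : ObliviousAVC X S Y) (L : ℕ) : Set ((Fin L → X) → S → ℝ) :=
  {U | (∀ x, U x ∈ stdSimplex ℝ S) ∧
    ∀ (x : Fin (L + 1) → X) (y : Y) (π : Equiv.Perm (Fin (L + 1))),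
      ∑ s, A.W (x 0) s y * U (fun i => x i.succ) s =
        ∑ s, A.W (x (π 0)) s y * U (fun i => x (π i.succ)) s}

lemma mem_symmetrizing_iff {A : ObliviousAVC X S Y} {L k : ℕ}
    {U : Fin k → (Fin L → X) → S → ℝ} :
    U ∈ A.symmetrizing L k ↔ ∀ u, U u ∈ A.symmetrizingKernels L :=
  ⟨fun h u => ⟨h.1 u, h.2 u⟩, fun h => ⟨fun u => (h u).1, fun u => (h u).2⟩⟩

lemma convex_symmetrizingKernels (A : ObliviousAVC X S Y) (L : ℕ) :
    Convex ℝ (A.symmetrizingKernels L) := by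
  intro U hU V hV a b ha hb hab
  refine ⟨fun x => convex_stdSimplex ℝ S (hU.1 x) (hV.1 x) ha hb hab, fun x y π => ?_⟩
  have e : ∀ (c : X) (z : Fin L → X), ∑ s, A.W c s y * (a • U + b • V) z s =
      a * ∑ s, A.W c s y * U z s + b * ∑ s, A.W c s y * V z s := fun c z => by
    rw [Finset.mul_sum, Finset.mul_sum, ← Finset.sum_add_distrib]
    refine Finset.sum_congr rfl fun s _ => ?_
    simp only [Pi.add_apply, Pi.smul_apply, smul_eq_mul]
    ring
  rw [e, e, hU.2 x y π, hV.2 x y π]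

lemma kernelMarginal_mem_stdSimplex {L : ℕ} {p : X → ℝ} (hp : p ∈ stdSimplex ℝ X)
    {U : (Fin L → X) → S → ℝ} (hU : ∀ x, U x ∈ stdSimplex ℝ S) :
    kernelMarginal L p U ∈ stdSimplex ℝ S :=
  (convex_stdSimplex ℝ S).sum_mem (fun _ _ => Finset.prod_nonneg fun _ _ => hp.1 _)
    (sum_prod_stdSimplex fun _ => hp) fun x _ => hU x

lemma jammingMarginal_mem_stdSimplex {L k : ℕ} {Pu : Fin k → ℝ} {Pxu : Fin k → X → ℝ}
    (hPu : Pu ∈ stdSimplex ℝ (Fin k)) (hPxu : ∀ u, Pxu u ∈ stdSimplex ℝ X)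
    {U : Fin k → (Fin L → X) → S → ℝ} (hU : ∀ u x, U u x ∈ stdSimplex ℝ S) :
    jammingMarginal Pu Pxu U ∈ stdSimplex ℝ S := by
  rw [jammingMarginal_eq]
  exact (convex_stdSimplex ℝ S).sum_mem (fun u _ => hPu.1 u) hPu.2
    fun u _ => kernelMarginal_mem_stdSimplex (hPxu u) (hU u)

/-- Averaging a symmetrizing kernel over its last input leaves a symmetrizing kernel with the same
state distribution. -/
lemma exists_symmetrizingKernels_pred (A : ObliviousAVC X S Y) {L : ℕ} {p : X → ℝ}
    (hp : p ∈ stdSimplex ℝ X) {U : (Fin (L + 1) → X) → S → ℝ}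
    (hU : U ∈ A.symmetrizingKernels (L + 1)) :
    ∃ V ∈ A.symmetrizingKernels L, kernelMarginal L p V = kernelMarginal (L + 1) p U := by
  refine ⟨fun x => ∑ z, p z • U (Fin.snoc x z), ⟨fun x => ?_, fun x y π => ?_⟩, ?_⟩
  · exact (convex_stdSimplex ℝ S).sum_mem (fun z _ => hp.1 z) hp.2 fun z _ => hU.1 _
  · have e : ∀ (c : X) (w : Fin L → X), ∑ s, A.W c s y * (∑ z, p z • U (Fin.snoc w z)) s =
        ∑ z, p z * ∑ s, A.W c s y * U (Fin.snoc w z) s := fun c w => by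
      simp only [Finset.sum_apply, Pi.smul_apply, smul_eq_mul, Finset.mul_sum]
      rw [Finset.sum_comm]
      exact Finset.sum_congr rfl fun _ _ => Finset.sum_congr rfl fun _ _ => by ring
    rw [e, e]
    refine Finset.sum_congr rfl fun z _ => ?_
    congr 1
    -- `π` is extended by fixing the last position, the one that is averaged.
    set π' : Equiv.Perm (Fin (L + 1 + 1)) :=
      (finSuccEquivLast.trans (Equiv.optionCongr π)).trans finSuccEquivLast.symm with hπ'
    have h1 : ∀ i : Fin (L + 1), π' i.castSucc = (π i).castSucc := fun i => by simp [hπ']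
    have h2 : π' (Fin.last _) = Fin.last _ := by simp [hπ']
    have h := hU.2 (Fin.snoc x z) y π'
    have e0 : (0 : Fin (L + 1 + 1)) = (0 : Fin (L + 1)).castSucc := rfl
    have e1 : (fun i : Fin (L + 1) => (Fin.snoc x z : Fin (L + 1 + 1) → X) i.succ) =
        (Fin.snoc (fun i : Fin L => x i.succ) z : Fin (L + 1) → X) := by
      funext i
      refine Fin.lastCases ?_ (fun i => ?_) i
      · rw [Fin.succ_last, Fin.snoc_last, Fin.snoc_last]
      · rw [Fin.succ_castSucc, Fin.snoc_castSucc, Fin.snoc_castSucc]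
    have e2 : (fun i : Fin (L + 1) => (Fin.snoc x z : Fin (L + 1 + 1) → X) (π' i.succ)) =
        (Fin.snoc (fun i : Fin L => x (π i.succ)) z : Fin (L + 1) → X) := by
      funext i
      refine Fin.lastCases ?_ (fun i => ?_) i
      · rw [Fin.succ_last, h2, Fin.snoc_last, Fin.snoc_last]
      · rw [Fin.succ_castSucc, h1, Fin.snoc_castSucc, Fin.snoc_castSucc]
    rw [e1, e2, e0, h1, Fin.snoc_castSucc, Fin.snoc_castSucc] at h
    exact h
  · simp only [kernelMarginal, LinearMap.coe_mk, AddHom.coe_mk]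
    rw [← (Fin.snocEquiv fun _ : Fin (L + 1) => X).sum_comp, Fintype.sum_prod_type_right]
    refine Finset.sum_congr rfl fun x _ => ?_
    rw [Finset.smul_sum]
    refine Finset.sum_congr rfl fun z _ => ?_
    rw [smul_smul, Fin.prod_univ_castSucc]
    simp [Fin.snocEquiv]

/-- Since `Lcp` is built from suprema, `L ≤ Lcp` only yields symmetrizability at some larger list
size; this lemma descends to `L` without changing the state distribution. -/
lemma exists_symmetrizing_of_le (A : ObliviousAVC X S Y) {L L' k : ℕ} (hLL' : L ≤ L')
    {Pu : Fin k → ℝ} {Pxu : Fin k → X → ℝ} (hPxu : ∀ u, Pxu u ∈ stdSimplex ℝ X) {C : Set (S → ℝ)}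
    (h : ∃ U ∈ A.symmetrizing L' k, jammingMarginal Pu Pxu U ∈ C) :
    ∃ U ∈ A.symmetrizing L k, jammingMarginal Pu Pxu U ∈ C := by
  induction L', hLL' using Nat.le_induction with
  | base => exact h
  | succ L' _ ih =>
    obtain ⟨U, hU, hUC⟩ := h
    choose V hV hVU using fun u =>
      A.exists_symmetrizingKernels_pred (hPxu u) (mem_symmetrizing_iff.1 hU u)
    refine ih ⟨V, mem_symmetrizing_iff.2 hV, ?_⟩
    rw [jammingMarginal_eq] at hUC ⊢
    simpa only [hVU] using hUC

/-! ### Symmetrization with a uniform margin -/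

variable [DecidableEq X]

lemma exists_le_cpSymmetrizable (A : ObliviousAVC X S Y) {L : ℕ} (hL : 1 ≤ L)
    (hLcp : (L : ℕ∞) ≤ A.Lcp) {Px : X → ℝ} (hPx : Px ∈ A.inputSet) :
    ∃ L', L ≤ L' ∧ A.CPSymmetrizable L' Px := by
  by_contra! hcon
  have h1 : (L : ℕ∞) ≤ A.LcpAt Px := hLcp.trans (iInf₂_le Px hPx)
  have h2 : A.LcpAt Px ≤ ((L - 1 : ℕ) : ℕ∞) := by
    refine iSup₂_le fun L' hL' => ?_
    have : ¬ L ≤ L' := fun h => hcon L' h hL'.2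
    exact_mod_cast (by omega : L' ≤ L - 1)
  have h3 : L ≤ L - 1 := by exact_mod_cast h1.trans h2
  omega

lemma exists_symmetrizing_stateInterior (A : ObliviousAVC X S Y) {L : ℕ} (hL : 1 ≤ L)
    (hLcp : (L : ℕ∞) ≤ A.Lcp) (hint : A.NoBoundarySymmetrization L) {k : ℕ} {Pu : Fin k → ℝ}
    {Pxu : Fin k → X → ℝ} (hPu : Pu ∈ stdSimplex ℝ (Fin k)) (hPxu : ∀ u, Pxu u ∈ stdSimplex ℝ X)
    (hin : ∑ u, Pu u • Pxu u ∈ A.inputSet) :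
    ∃ U ∈ A.symmetrizing L k, jammingMarginal Pu Pxu U ∈ A.stateInterior := by
  obtain ⟨L', hLL', hsym⟩ := A.exists_le_cpSymmetrizable hL hLcp hin
  exact hint _ hin _ (mixture_mem_cpDistributions L hPu hPxu) k Pu Pxu
    ⟨hPu, hPxu, fun _ => rfl⟩ (A.exists_symmetrizing_of_le hLL' hPxu
      (hsym _ (mixture_mem_cpDistributions L' hPu hPxu) k Pu Pxu ⟨hPu, hPxu, fun _ => rfl⟩))

/-- For a time-sharing alphabet of fixed size, all cp-distributions can be symmetrized within a
polytope with vertices in the interior of the state constraints. -/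
lemma exists_finite_symmetrizing_convexHull (A : ObliviousAVC X S Y) {L : ℕ} (hL : 1 ≤ L)
    (hLcp : (L : ℕ∞) ≤ A.Lcp) (hint : A.NoBoundarySymmetrization L) (k : ℕ) :
    ∃ F : Set (S → ℝ), F.Finite ∧ F ⊆ A.stateInterior ∧
      ∀ (Pu : Fin k → ℝ) (Pxu : Fin k → X → ℝ), Pu ∈ stdSimplex ℝ (Fin k) →
        (∀ u, Pxu u ∈ stdSimplex ℝ X) → ∑ u, Pu u • Pxu u ∈ A.inputSet →
        ∃ U ∈ A.symmetrizing L k, jammingMarginal Pu Pxu U ∈ convexHull ℝ F := by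
  set K : Set ((Fin k → ℝ) × (Fin k → X → ℝ)) :=
    (stdSimplex ℝ (Fin k) ×ˢ Set.univ.pi fun _ => stdSimplex ℝ X) ∩
      (fun z => ∑ u, z.1 u • z.2 u) ⁻¹' A.inputSet with hK
  have hKc : IsCompact K :=
    ((isCompact_stdSimplex ℝ (Fin k)).prod
      (isCompact_univ_pi fun _ => isCompact_stdSimplex ℝ X)).inter_right
        (A.input_closed.preimage (by fun_prop))
  suffices h : ∃ F : Set (S → ℝ), F.Finite ∧ F ⊆ A.stateInterior ∧
      ∀ z ∈ K, ∃ U ∈ A.symmetrizing L k, jammingMarginal z.1 z.2 U ∈ convexHull ℝ F by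
    obtain ⟨F, hF, hFI, h⟩ := h
    exact ⟨F, hF, hFI, fun Pu Pxu h1 h2 h3 => h (Pu, Pxu) ⟨⟨h1, fun u _ => h2 u⟩, h3⟩⟩
  refine hKc.induction_on (p := fun K' => ∃ F : Set (S → ℝ), F.Finite ∧ F ⊆ A.stateInterior ∧
      ∀ z ∈ K', ∃ U ∈ A.symmetrizing L k, jammingMarginal z.1 z.2 U ∈ convexHull ℝ F)
    ⟨∅, Set.finite_empty, Set.empty_subset _, by simp⟩ ?_ ?_ ?_
  · rintro s t hst ⟨F, hF, hFI, h⟩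
    exact ⟨F, hF, hFI, fun z hz => h z (hst hz)⟩
  · rintro s t ⟨F, hF, hFI, h⟩ ⟨G, hG, hGI, h'⟩
    refine ⟨F ∪ G, hF.union hG, Set.union_subset hFI hGI, ?_⟩
    rintro z (hz | hz)
    · obtain ⟨U, hU, hUF⟩ := h z hz
      exact ⟨U, hU, convexHull_mono Set.subset_union_left hUF⟩
    · obtain ⟨U, hU, hUF⟩ := h' z hz
      exact ⟨U, hU, convexHull_mono Set.subset_union_right hUF⟩
  · intro z hz
    obtain ⟨U, hU, hUI⟩ := A.exists_symmetrizing_stateInterior hL hLcp hint hz.1.1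
      (fun u => hz.1.2 u trivial) hz.2
    obtain ⟨F, hF, hFI, hFn⟩ := exists_finite_convexHull_mem_nhdsWithin hUI.1 hUI.2
    -- The same `U` serves a whole neighbourhood, because its state marginal is continuous in the
    -- decomposition.
    have hcont : Continuous fun z : (Fin k → ℝ) × (Fin k → X → ℝ) =>
        jammingMarginal z.1 z.2 U := by
      unfold jammingMarginal
      fun_prop
    have htend : Tendsto (fun z : (Fin k → ℝ) × (Fin k → X → ℝ) => jammingMarginal z.1 z.2 U)
        (𝓝[K] z) (𝓝[stdSimplex ℝ S] jammingMarginal z.1 z.2 U) :=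
      hcont.continuousWithinAt.tendsto_nhdsWithin fun z' hz' =>
        jammingMarginal_mem_stdSimplex hz'.1.1 (fun u => hz'.1.2 u trivial) hU.1
    exact ⟨_, htend hFn, F, hF, hFI, fun z' hz' => ⟨U, hU, hz'⟩⟩

/-- Symmetrization is possible with a distance from the boundary of the state constraints that
does not depend on the size of the time-sharing alphabet. -/
theorem exists_symmetrizing_margin (A : ObliviousAVC X S Y) {L : ℕ} (hL : 1 ≤ L)
    (hLcp : (L : ℕ∞) ≤ A.Lcp) (hint : A.NoBoundarySymmetrization L) :
    ∃ δ : ℝ, 0 < δ ∧ ∀ (k : ℕ) (Pu : Fin k → ℝ) (Pxu : Fin k → X → ℝ),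
      Pu ∈ stdSimplex ℝ (Fin k) → (∀ u, Pxu u ∈ stdSimplex ℝ X) →
      ∑ u, Pu u • Pxu u ∈ A.inputSet →
      ∃ U ∈ A.symmetrizing L k, ∀ P ∈ stdSimplex ℝ S,
        (∀ b, |P b - jammingMarginal Pu Pxu U b| < δ) → P ∈ A.stateSet := by
  choose F hF hFI hFU using A.exists_finite_symmetrizing_convexHull hL hLcp hint
  -- By the reduction of the support only alphabets of size at most `|X|` matter, so finitely many
  -- polytopes suffice.
  set G : Set (S → ℝ) := ⋃ k ∈ Finset.range (Fintype.card X + 1), F k with hG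
  obtain ⟨δ, hδ, hmargin⟩ := exists_margin_convexHull A.state_convex
    ((Finset.finite_toSet _).biUnion fun k _ => hF k : G.Finite)
    (Set.iUnion₂_subset fun k _ => hFI k)
  refine ⟨δ, hδ, fun n w p hw hp hin => ?_⟩
  have hsmall : ∀ w' ∈ stdSimplex ℝ (Fin n), ∑ j, w' j • p j = ∑ j, w j • p j →
      (Finset.univ.filter fun j => w' j ≠ 0).card ≤ Fintype.card X →
      ∃ v : Fin n → S → ℝ, (∀ j, v j ∈ kernelMarginal L (p j) '' A.symmetrizingKernels L) ∧
        ∑ j, w' j • v j ∈ convexHull ℝ G := by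
    intro w' hw' hB hcard
    set T := Finset.univ.filter fun j => w' j ≠ 0 with hT
    set e : Fin T.card ≃ T := T.equivFin.symm with he
    obtain ⟨U, hU, hUF⟩ := hFU T.card (fun i => w' (e i)) (fun i => p (e i))
      ⟨fun i => hw'.1 _, by simpa [hw'.2] using sum_equivFin_support_smul w' fun _ => (1 : ℝ)⟩ (fun i => hp _)
      (by rw [sum_equivFin_support_smul w' p, hB]; exact hin)
    rw [mem_symmetrizing_iff] at hU
    -- Indices of weight zero need some symmetrizing kernel; any value of the `U` on the nonempty
    -- support will do.
    obtain ⟨U₀, hU₀⟩ : ∃ U₀, U₀ ∈ A.symmetrizingKernels L := by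
      have hTn : T.Nonempty := by
        by_contra hcon
        rw [Finset.not_nonempty_iff_eq_empty] at hcon
        have := hw'.2
        rw [Finset.sum_eq_zero fun j _ => ?_] at this
        · exact zero_ne_one this
        · by_contra h0
          have : j ∈ T := by simp [hT, h0]
          simp [hcon] at this
      exact ⟨_, hU ⟨0, hTn.card_pos⟩⟩
    set V : Fin n → (Fin L → X) → S → ℝ :=
      fun j => if h : j ∈ T then U (e.symm ⟨j, h⟩) else U₀ with hV
    refine ⟨fun j => kernelMarginal L (p j) (V j), fun j => ⟨V j, ?_, rfl⟩, ?_⟩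
    · simp only [hV]
      split_ifs
      exacts [hU _, hU₀]
    · rw [← sum_equivFin_support_smul w']
      have hVe : ∀ i, V (e i) = U i := fun i => by simp [hV]
      change ∑ i, w' (e i) • kernelMarginal L (p (e i)) (V (e i)) ∈ _
      simp only [hVe]
      rw [jammingMarginal_eq] at hUF
      refine convexHull_mono ?_ hUF
      exact Set.subset_biUnion_of_mem (u := F)
        (Finset.mem_coe.2 (Finset.mem_range.2 (by omega)))
  obtain ⟨v, hv, hvG⟩ := exists_mixture_mem_of_small_support hp
    (K := fun j => kernelMarginal L (p j) '' A.symmetrizingKernels L)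
    (fun j => (A.convex_symmetrizingKernels L).linear_image _)
    (convex_convexHull ℝ G) (B := ∑ u, w u • p u) hsmall hw rfl
  choose U hU hUv using hv
  refine ⟨U, mem_symmetrizing_iff.2 hU, fun P hP hclose => hmargin _ hvG P hP fun b => ?_⟩
  have := hclose b
  rw [jammingMarginal_eq] at this
  simpa only [hUv] using this

end ObliviousAVC

/-! ### Order embeddings -/

lemma card_orderEmbedding_fin (k : ℕ) (I : Type*) [LinearOrder I] [Fintype I]
    [Fintype (Fin k ↪o I)] : Fintype.card (Fin k ↪o I) = (Fintype.card I).choose k := by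
  rw [← Nat.card_eq_fintype_card, Nat.card_congr Set.powersetCard.ofFinEmbEquiv,
    Set.powersetCard.card, Nat.card_eq_fintype_card]

/-- The removed element and the remaining ones determine the range, and a strictly monotone map is
determined by its range. Thus a pair of sent message and spoofed tuple arises from at most one `(L +
1)`-set. -/
lemma injective_apply_comp_succAbove (L : ℕ) (I : Type*) [LinearOrder I] :
    Function.Injective fun er : (Fin (L + 1) ↪o I) × Fin (L + 1) =>
      ((er.1 er.2, fun i => er.1 (er.2.succAbove i)) : I × (Fin L → I)) := by
  rintro ⟨e, r⟩ ⟨e', r'⟩ h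
  simp only [Prod.mk.injEq] at h
  have hrange : ∀ (f : Fin (L + 1) ↪o I) (p : Fin (L + 1)),
      Set.range f = insert (f p) (Set.range fun i => f (p.succAbove i)) := fun f p => by
    rw [show (fun i => f (p.succAbove i)) = f ∘ p.succAbove from rfl, Set.range_comp,
      Fin.range_succAbove, ← Set.image_insert_eq, ← Set.image_univ]
    congr 1
    ext i
    simp [em]
  have he : e = e' := by
    apply DFunLike.coe_injective
    rw [← StrictMono.range_inj e.strictMono e'.strictMono, hrange e r, hrange e' r', h.1, h.2]
  subst he
  rw [e.injective h.1]

lemma sum_comp_le_sum_of_injective {α β : Type*} [Fintype α] [Fintype β] {f : α → β}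
    (hf : Function.Injective f) {g : β → ℝ} (hg : ∀ b, 0 ≤ g b) : ∑ a, g (f a) ≤ ∑ b, g b :=
  (Finset.sum_map Finset.univ ⟨f, hf⟩ g).symm.le.trans (Finset.sum_le_univ_sum_of_nonneg hg)

/-! ### Error probability under spoofing -/

namespace ObliviousAVC

variable {X S Y : Type*} [Fintype X] [Fintype S] [Fintype Y]

lemma Wn_nonneg (A : ObliviousAVC X S Y) {n : ℕ} (x : Fin n → X) (s : Fin n → S)
    (y : Fin n → Y) : 0 ≤ A.Wn x s y :=
  Finset.prod_nonneg fun _ _ => (A.W_mem _ _).1 _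

lemma sum_Wn (A : ObliviousAVC X S Y) {n : ℕ} (x : Fin n → X) (s : Fin n → S) :
    ∑ y, A.Wn x s y = 1 :=
  sum_prod_stdSimplex fun j => A.W_mem (x j) (s j)

/-- The law of the state sequence when the words `c` are passed letter by letter through `U`. -/
def wordLaw {L n : ℕ} (U : Fin n → (Fin L → X) → S → ℝ) (c : Fin L → Fin n → X)
    (s : Fin n → S) : ℝ :=
  ∏ j, U j (fun i => c i j) (s j)

lemma wordLaw_nonneg {A : ObliviousAVC X S Y} {L n : ℕ} {U : Fin n → (Fin L → X) → S → ℝ}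
    (hU : U ∈ A.symmetrizing L n) (c : Fin L → Fin n → X) (s : Fin n → S) : 0 ≤ wordLaw U c s :=
  Finset.prod_nonneg fun _ _ => (hU.1 _ _).1 _

lemma sum_wordLaw {A : ObliviousAVC X S Y} {L n : ℕ} {U : Fin n → (Fin L → X) → S → ℝ}
    (hU : U ∈ A.symmetrizing L n) (c : Fin L → Fin n → X) : ∑ s, wordLaw U c s = 1 :=
  sum_prod_stdSimplex fun _ => hU.1 _ _

/-- The output is the same whichever of the `L + 1` words is sent and the others are spoofed. -/
lemma sum_wordLaw_mul_Wn {A : ObliviousAVC X S Y} {L n : ℕ} {U : Fin n → (Fin L → X) → S → ℝ}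
    (hU : U ∈ A.symmetrizing L n) (c : Fin (L + 1) → Fin n → X) (r : Fin (L + 1))
    (y : Fin n → Y) :
    ∑ s, wordLaw U (fun i => c (r.succAbove i)) s * A.Wn (c r) s y =
      ∑ s, wordLaw U (fun i => c i.succ) s * A.Wn (c 0) s y := by
  have h : ∀ (c' : Fin L → Fin n → X) (x : Fin n → X), ∑ s, wordLaw U c' s * A.Wn x s y =
      ∏ j, ∑ s, A.W (x j) s (y j) * U j (fun i => c' i j) s := fun c' x => by
    rw [Fintype.prod_sum]
    refine Finset.sum_congr rfl fun s _ => ?_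
    rw [wordLaw, Wn, ← Finset.prod_mul_distrib]
    exact Finset.prod_congr rfl fun j _ => mul_comm _ _
  rw [h, h]
  refine Finset.prod_congr rfl fun j _ => ?_
  -- The inverse of `r.cycleRange` sends `0` to `r` and `i.succ` to `r.succAbove i`.
  have := hU.2 j (fun i => c i j) (y j) r.cycleRange.symm
  simpa only [Fin.cycleRange_symm_zero, Fin.cycleRange_symm_succ] using this.symm

variable [DecidableEq X]

/-- The probability of list-decoding error for the message `i` and the state sequence `s`. -/
def errorProb (A : ObliviousAVC X S Y) {L n M : ℕ} (φ : A.Encoder n M) (ψ : ListDecoder Y L n M)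
    (i : Fin M) (s : Fin n → S) : ℝ :=
  ∑ y ∈ Finset.univ.filter (fun y : Fin n → Y => i ∉ ψ.dec y), A.Wn (φ.enc i) s y

lemma errorProb_nonneg (A : ObliviousAVC X S Y) {L n M : ℕ} (φ : A.Encoder n M)
    (ψ : ListDecoder Y L n M) (i : Fin M) (s : Fin n → S) : 0 ≤ A.errorProb φ ψ i s :=
  Finset.sum_nonneg fun _ _ => A.Wn_nonneg _ _ _

lemma errorProb_le_one (A : ObliviousAVC X S Y) {L n M : ℕ} (φ : A.Encoder n M)
    (ψ : ListDecoder Y L n M) (i : Fin M) (s : Fin n → S) : A.errorProb φ ψ i s ≤ 1 := by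
  rw [← A.sum_Wn (φ.enc i) s]
  exact Finset.sum_le_univ_sum_of_nonneg fun _ => A.Wn_nonneg _ _ _

/-- If each of `L + 1` messages is sent in turn while the others are spoofed, then the error
probabilities add up to at least `1`. -/
lemma one_le_sum_wordLaw_mul_errorProb {A : ObliviousAVC X S Y} {L n M : ℕ}
    {U : Fin n → (Fin L → X) → S → ℝ} (hU : U ∈ A.symmetrizing L n) (φ : A.Encoder n M)
    (ψ : ListDecoder Y L n M) {e : Fin (L + 1) → Fin M} (he : Function.Injective e) :
    1 ≤ ∑ r, ∑ s, wordLaw U (fun i => φ.enc (e (r.succAbove i))) s *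
      A.errorProb φ ψ (e r) s := by
  set Z : (Fin n → Y) → ℝ := fun y =>
    ∑ s, wordLaw U (fun i : Fin L => φ.enc (e i.succ)) s * A.Wn (φ.enc (e 0)) s y with hZ
  have hZ0 : ∀ y, 0 ≤ Z y := fun y =>
    Finset.sum_nonneg fun s _ => mul_nonneg (wordLaw_nonneg hU _ _) (A.Wn_nonneg _ _ _)
  have hZ1 : ∑ y, Z y = 1 := by
    rw [hZ, Finset.sum_comm]
    simp only [← Finset.mul_sum, sum_Wn, mul_one, sum_wordLaw hU]
  have h1 : ∀ r, ∑ s, wordLaw U (fun i => φ.enc (e (r.succAbove i))) s *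
      A.errorProb φ ψ (e r) s = ∑ y, if e r ∉ ψ.dec y then Z y else 0 := fun r => by
    simp only [errorProb, Finset.mul_sum]
    rw [Finset.sum_comm, Finset.sum_filter]
    exact Finset.sum_congr rfl fun y _ => by
      rw [sum_wordLaw_mul_Wn hU (fun i => φ.enc (e i)) r y]
  simp only [h1]
  rw [Finset.sum_comm, ← hZ1]
  refine Finset.sum_le_sum fun y _ => ?_
  -- A list of at most `L` messages cannot contain `L + 1` distinct ones.
  obtain ⟨r, hr⟩ : ∃ r, e r ∉ ψ.dec y := by
    by_contra! hcon
    have h2 : (Finset.univ.image e).card ≤ (ψ.dec y).card :=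
      Finset.card_le_card fun i hi => by
        obtain ⟨r, -, rfl⟩ := Finset.mem_image.1 hi
        exact hcon r
    rw [Finset.card_image_of_injective _ he, Finset.card_univ, Fintype.card_fin] at h2
    have := ψ.card_le y
    omega
  refine le_trans (le_of_eq (if_pos hr).symm) (Finset.single_le_sum
    (f := fun r => if e r ∉ ψ.dec y then Z y else 0) (fun r _ => ?_) (Finset.mem_univ r))
  split_ifs
  exacts [le_rfl, hZ0 y]

variable [DecidableEq S]

open Classical in
/-- The error caused by feasible spoofed state sequences is large if, for a large set `B` of
messages, the words in `B` are rarely turned into infeasible state sequences. -/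
lemma choose_sub_le_sum_wordLaw_mul_errorProb {A : ObliviousAVC X S Y} {L n M : ℕ}
    {U : Fin n → (Fin L → X) → S → ℝ} (hU : U ∈ A.symmetrizing L n) (φ : A.Encoder n M)
    (ψ : ListDecoder Y L n M) (B : Finset (Fin M)) {κ : ℝ}
    (hκ : ∑ t : Fin L → B, ∑ s ∈ Finset.univ.filter (fun s => ¬ A.FeasibleState s),
      wordLaw U (fun i => φ.enc (t i)) s ≤ κ * (B.card : ℝ) ^ L) :
    (B.card.choose (L + 1) : ℝ) - κ * (B.card : ℝ) ^ (L + 1) ≤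
      ∑ i : Fin M, ∑ l : Fin L ↪o Fin M, ∑ s ∈ Finset.univ.filter (fun s => A.FeasibleState s),
        wordLaw U (fun i => φ.enc (l i)) s * A.errorProb φ ψ i s := by
  set good : Fin M → (Fin L → Fin M) → ℝ := fun i t =>
    ∑ s ∈ Finset.univ.filter (fun s => A.FeasibleState s),
      wordLaw U (fun i => φ.enc (t i)) s * A.errorProb φ ψ i s with hgood
  set bad : (Fin L → Fin M) → ℝ := fun t =>
    ∑ s ∈ Finset.univ.filter (fun s => ¬ A.FeasibleState s),
      wordLaw U (fun i => φ.enc (t i)) s with hbad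
  have hgood0 : ∀ i t, 0 ≤ good i t := fun i t => Finset.sum_nonneg fun s _ =>
    mul_nonneg (wordLaw_nonneg hU _ _) (A.errorProb_nonneg _ _ _ _)
  have hbad0 : ∀ t, 0 ≤ bad t := fun t => Finset.sum_nonneg fun s _ => wordLaw_nonneg hU _ _
  have hle : ∀ i t, ∑ s, wordLaw U (fun i => φ.enc (t i)) s * A.errorProb φ ψ i s ≤
      good i t + bad t := fun i t => by
    rw [← Finset.sum_filter_add_sum_filter_not Finset.univ (fun s => A.FeasibleState s)]
    gcongr
    exact Finset.sum_le_sum fun s _ =>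
      mul_le_of_le_one_right (wordLaw_nonneg hU _ _) (A.errorProb_le_one _ _ _ _)
  have hinj := injective_apply_comp_succAbove L B
  have hcard : (B.card.choose (L + 1) : ℝ) = ∑ _e : Fin (L + 1) ↪o B, (1 : ℝ) := by
    simp [card_orderEmbedding_fin]
  have h1 : (B.card.choose (L + 1) : ℝ) ≤ ∑ er : (Fin (L + 1) ↪o B) × Fin (L + 1),
      (good (er.1 er.2) (fun i => er.1 (er.2.succAbove i)) +
        bad fun i => er.1 (er.2.succAbove i)) := by
    rw [hcard, Fintype.sum_prod_type]
    refine Finset.sum_le_sum fun e _ => ?_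
    refine (one_le_sum_wordLaw_mul_errorProb hU φ ψ (e := fun i => (e i : Fin M))
      (Subtype.val_injective.comp e.injective)).trans (Finset.sum_le_sum fun r _ => hle _ _)
  rw [Finset.sum_add_distrib] at h1
  -- Infeasible mass does not depend on the sent message, which contributes only the factor `|B|`.
  have h2 : ∑ er : (Fin (L + 1) ↪o B) × Fin (L + 1), bad (fun i => er.1 (er.2.succAbove i)) ≤
      κ * (B.card : ℝ) ^ (L + 1) := by
    refine (sum_comp_le_sum_of_injective hinj
      (g := fun it : B × (Fin L → B) => bad fun i => it.2 i) fun _ => hbad0 _).trans ?_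
    rw [Fintype.sum_prod_type]
    simp only [Finset.sum_const, Finset.card_univ, Fintype.card_coe, nsmul_eq_mul]
    calc _ ≤ (B.card : ℝ) * (κ * (B.card : ℝ) ^ L) := by gcongr
      _ = _ := by ring
  have h3 : ∑ er : (Fin (L + 1) ↪o B) × Fin (L + 1),
      good (er.1 er.2) (fun i => er.1 (er.2.succAbove i)) ≤
        ∑ i : Fin M, ∑ l : Fin L ↪o Fin M, good i l := by
    rw [← Fintype.sum_prod_type']
    refine sum_comp_le_sum_of_injective (f := fun er : (Fin (L + 1) ↪o B) × Fin (L + 1) =>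
      (((er.1 er.2 : B) : Fin M),
        ((Fin.succAboveOrderEmb er.2).trans er.1).trans (OrderEmbedding.subtype (· ∈ B))))
      ?_ (g := fun il : Fin M × (Fin L ↪o Fin M) => good il.1 il.2) fun _ => hgood0 _ _
    intro a b hab
    rw [Prod.mk.injEq] at hab
    refine hinj (Prod.ext (Subtype.ext hab.1) (funext fun i => Subtype.ext ?_))
    exact DFunLike.congr_fun hab.2 i
  linarith

end ObliviousAVC

lemma choose_succ_ge_of_two_mul_le {a L : ℕ} (h : 2 * L ≤ a) :
    (a : ℝ) ^ (L + 1) / (2 ^ (L + 1) * (L + 1).factorial) ≤ a.choose (L + 1) := by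
  have h1 : ((a - L : ℕ) : ℝ) ^ (L + 1) ≤ a.descFactorial (L + 1) := by
    have := Nat.pow_sub_le_descFactorial a (L + 1)
    rw [Nat.add_sub_add_right] at this
    exact_mod_cast this
  have h2 : (a : ℝ) / 2 ≤ ((a - L : ℕ) : ℝ) := by
    rw [Nat.cast_sub (by omega)]
    have : (2 : ℝ) * L ≤ a := by exact_mod_cast h
    linarith
  have h3 : ((a : ℝ) / 2) ^ (L + 1) ≤ (L + 1).factorial * a.choose (L + 1) := by
    rw [← Nat.cast_mul, ← Nat.descFactorial_eq_factorial_mul_choose]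
    exact (pow_le_pow_left₀ (by positivity) h2 _).trans h1
  rw [div_pow, div_le_iff₀ (by positivity)] at h3
  rw [div_le_iff₀ (by positivity)]
  linarith

lemma empType_eq {T : Type*} [DecidableEq T] {n : ℕ} (v : Fin n → T) (a : T) :
    empType v a = (n : ℝ)⁻¹ * ∑ j, if v j = a then 1 else 0 := by
  simp [empType, div_eq_inv_mul]

lemma empType_mem_stdSimplex {T : Type*} [Fintype T] [DecidableEq T] {n : ℕ} (hn : 0 < n)
    (v : Fin n → T) : empType v ∈ stdSimplex ℝ T := by
  have : Nonempty (Fin n) := ⟨⟨0, hn⟩⟩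
  have h : empType v = letterFreq v := by
    funext a
    rw [empType_eq, letterFreq, Fintype.card_fin]
  rw [h]
  exact letterFreq_mem_stdSimplex v

/-! ### The attack on codes of positive rate -/

namespace ObliviousAVC

variable {X S Y : Type*} [Fintype X] [Fintype S] [Fintype Y]

/-- A code of positive rate has at least `2 ^ (n R)` messages. -/
lemma exp_le_of_le_rate {A : ObliviousAVC X S Y} {n M : ℕ} {R : ℝ} (hR : 0 < R) (hn : 0 < n)
    (h : R ≤ A.rate n M) : Real.exp (R * Real.log 2 * n) ≤ M := by
  have hn0 : (0 : ℝ) < n := by exact_mod_cast hn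
  unfold rate at h
  -- With division by zero equal to `0`, a positive rate excludes alphabets with fewer than two
  -- letters.
  have hX0 : Real.log (Fintype.card X) ≠ 0 := fun h0 => by
    rw [h0, mul_zero, div_zero] at h
    linarith
  have hX2 : 2 ≤ Fintype.card X := by
    by_contra! hlt
    interval_cases hc : Fintype.card X <;> simp at hX0
  have hlog : Real.log 2 ≤ Real.log (Fintype.card X) :=
    Real.log_le_log two_pos (by exact_mod_cast hX2)
  have hlog2 : 0 < Real.log 2 := Real.log_pos one_lt_two
  rw [le_div_iff₀ (mul_pos hn0 (hlog2.trans_le hlog))] at h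
  have h1 : R * Real.log 2 * n ≤ Real.log M := by
    calc R * Real.log 2 * n = R * (n * Real.log 2) := by ring
      _ ≤ R * (n * Real.log (Fintype.card X)) := by gcongr
      _ ≤ _ := h
  have hM : (0 : ℝ) < M := by
    rcases Nat.eq_zero_or_pos M with rfl | hM
    · simp only [Nat.cast_zero, Real.log_zero] at h1
      have : 0 < R * Real.log 2 * n := by positivity
      linarith
    · exact_mod_cast hM
  exact (Real.le_log_iff_exp_le hM).1 h1

variable [DecidableEq X]

/-- The letter frequencies of a subcode, averaged over the positions, satisfy the input
constraints. -/
lemma sum_letterFreq_mem_inputSet (A : ObliviousAVC X S Y) {n M : ℕ} (φ : A.Encoder n M)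
    {B : Finset (Fin M)} (hB : B.Nonempty) :
    ∑ j : Fin n, (n : ℝ)⁻¹ • letterFreq (fun i : B => φ.enc i j) ∈ A.inputSet := by
  have hB0 : (0 : ℝ) < B.card := by exact_mod_cast hB.card_pos
  have h : ∑ j : Fin n, (n : ℝ)⁻¹ • letterFreq (fun i : B => φ.enc i j) =
      ∑ i : B, (B.card : ℝ)⁻¹ • empType (φ.enc i) := by
    funext a
    simp only [Finset.sum_apply, Pi.smul_apply, smul_eq_mul, letterFreq, empType_eq,
      Fintype.card_coe, ← Finset.mul_sum]
    rw [Finset.sum_comm]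
    ring
  rw [h]
  exact A.input_convex.sum_mem (fun _ _ => by positivity) (by simp [hB0.ne'])
    fun i _ => φ.feasible i

lemma spoofedLaw_nonneg {A : ObliviousAVC X S Y} {L n M : ℕ}
    {U : Fin n → (Fin L → X) → S → ℝ} (hU : U ∈ A.symmetrizing L n) (φ : A.Encoder n M)
    (s : Fin n → S) : 0 ≤ A.spoofedLaw φ id U s :=
  mul_nonneg (by positivity) (Finset.sum_nonneg fun _ _ => wordLaw_nonneg hU _ s)

lemma sum_spoofedLaw {A : ObliviousAVC X S Y} {L n M : ℕ} (hLM : L ≤ M)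
    {U : Fin n → (Fin L → X) → S → ℝ} (hU : U ∈ A.symmetrizing L n) (φ : A.Encoder n M) :
    ∑ s, A.spoofedLaw φ id U s = 1 := by
  have h : ∀ s, A.spoofedLaw φ id U s = (1 / (M.choose L : ℝ)) *
      ∑ l : Fin L ↪o Fin M, wordLaw U (fun i => φ.enc (l i)) s := fun s => rfl
  have h0 : (M.choose L : ℝ) ≠ 0 := by exact_mod_cast (Nat.choose_pos hLM).ne'
  simp only [h]
  rw [← Finset.mul_sum, Finset.sum_comm]
  simp [sum_wordLaw hU, card_orderEmbedding_fin, h0]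

variable [DecidableEq S]

open Classical in
/-- On a subcode of small variation, a kernel whose state distribution has distance `δ` from the
boundary of the state constraints rarely leads to infeasible state sequences. -/
lemma sum_infeasible_wordLaw_le {A : ObliviousAVC X S Y} {L n M : ℕ} (hn : 0 < n)
    (φ : A.Encoder n M) {B : Finset (Fin M)} (hB : B.Nonempty) {η θ δ : ℝ} (hθ : 0 < θ)
    (hδ : 0 < δ)
    (hreg : ∀ f : Fin n → X → ℝ, (∀ j a, f j a ∈ Set.Icc (0 : ℝ) 1) →
      ∑ i : B, |∑ j, (f j (φ.enc i j) -
        ∑ a, letterFreq (fun i : B => φ.enc i j) a * f j a)| ≤ η * n * Fintype.card B)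
    {U : Fin n → (Fin L → X) → S → ℝ} (hU : U ∈ A.symmetrizing L n)
    (hmargin : ∀ P ∈ stdSimplex ℝ S, (∀ b, |P b - jammingMarginal (fun _ => (n : ℝ)⁻¹)
      (fun j => letterFreq fun i : B => φ.enc i j) U b| < δ) → P ∈ A.stateSet) :
    ∑ t : Fin L → B, ∑ s ∈ Finset.univ.filter (fun s => ¬ A.FeasibleState s),
      wordLaw U (fun i => φ.enc (t i)) s ≤
        Fintype.card S * (1 / (θ * n) + θ + L * η) / δ * (B.card : ℝ) ^ L := by
  have hn0 : (0 : ℝ) < n := by exact_mod_cast hn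
  have : Nonempty B := hB.to_subtype
  set dev : (Fin n → S) → S → ℝ := fun s b => |∑ j, ((if s j = b then 1 else 0) -
    ∑ y : Fin L → X, (∏ l, letterFreq (fun i : B => φ.enc i j) (y l)) * U j y b)| with hdev
  have hdev_eq : ∀ s b, |empType s b - jammingMarginal (fun _ => (n : ℝ)⁻¹)
      (fun j => letterFreq fun i : B => φ.enc i j) U b| = (n : ℝ)⁻¹ * dev s b := fun s b => by
    rw [← abs_of_pos (inv_pos.2 hn0), hdev, ← abs_mul, empType_eq, abs_of_pos (inv_pos.2 hn0)]
    simp only [jammingMarginal, Finset.sum_sub_distrib, mul_sub, Finset.mul_sum, mul_assoc]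
  -- Markov's inequality: an infeasible type is at least `δ` away from the marginal at some letter,
  -- so the indicator of infeasibility is dominated by the rescaled total deviation.
  have hinf : ∀ s, ¬ A.FeasibleState s → 1 ≤ (δ * n)⁻¹ * ∑ b, dev s b := fun s hs => by
    obtain ⟨b, hb⟩ : ∃ b, δ ≤ (n : ℝ)⁻¹ * dev s b := by
      by_contra! hcon
      exact hs (hmargin _ (empType_mem_stdSimplex hn s) fun b => by rw [hdev_eq]; exact hcon b)
    have h1 : dev s b ≤ ∑ b, dev s b :=
      Finset.single_le_sum (fun b _ => abs_nonneg _) (Finset.mem_univ b)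
    rw [inv_mul_eq_div, le_div_iff₀ hn0] at hb
    rw [inv_mul_eq_div, le_div_iff₀ (by positivity)]
    linarith
  have hpt : ∀ t : Fin L → B, ∑ s ∈ Finset.univ.filter (fun s => ¬ A.FeasibleState s),
      wordLaw U (fun i => φ.enc (t i)) s ≤
      ∑ s, wordLaw U (fun i => φ.enc (t i)) s * ((δ * n)⁻¹ * ∑ b, dev s b) := fun t => by
    have h0 : ∀ s, 0 ≤ wordLaw U (fun i => φ.enc (t i)) s := wordLaw_nonneg hU _
    refine (Finset.sum_le_sum fun s hs => le_mul_of_one_le_right (h0 s)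
      (hinf s (Finset.mem_filter.1 hs).2)).trans ?_
    exact Finset.sum_le_univ_sum_of_nonneg fun s => mul_nonneg (h0 s)
      (mul_nonneg (by positivity) (Finset.sum_nonneg fun b _ => abs_nonneg _))
  refine (Finset.sum_le_sum fun t _ => hpt t).trans ?_
  have hswap : ∑ t : Fin L → B, ∑ s, wordLaw U (fun i => φ.enc (t i)) s *
      ((δ * n)⁻¹ * ∑ b, dev s b) =
      (δ * n)⁻¹ * ∑ b, ∑ t : Fin L → B, ∑ s, wordLaw U (fun i => φ.enc (t i)) s * dev s b := by
    simp only [Finset.mul_sum]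
    rw [Finset.sum_comm (s := (Finset.univ : Finset S))]
    refine Finset.sum_congr rfl fun t _ => ?_
    rw [Finset.sum_comm]
    exact Finset.sum_congr rfl fun b _ => Finset.sum_congr rfl fun s _ => by ring
  rw [hswap]
  calc _ ≤ (δ * n)⁻¹ * ∑ _b : S, (1 / θ + θ * n + L * η * n) * (B.card : ℝ) ^ L := by
        gcongr with b
        have := sum_tuples_deviation_le hn (fun (i : B) => φ.enc i) hθ hreg U hU.1 b
        rwa [Fintype.card_coe] at this
    _ = _ := by
        simp only [Finset.sum_const, Finset.card_univ, nsmul_eq_mul]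
        field_simp

open Classical in
/-- The cp-symmetrization attack: spoof if the result is feasible, and send `s₀` otherwise. -/
def cpAttack (A : ObliviousAVC X S Y) {L n M k : ℕ} (φ : A.Encoder n M) (u : Fin n → Fin k)
    (U : Fin k → (Fin L → X) → S → ℝ) (s₀ : Fin n → S) : (Fin n → S) → ℝ :=
  fun s => (if A.FeasibleState s then A.spoofedLaw φ u U s else 0) +
    if s = s₀ then
      ∑ s' ∈ Finset.univ.filter (fun s' => ¬ A.FeasibleState s'), A.spoofedLaw φ u U s'
    else 0

lemma isJammingLaw_cpAttack {A : ObliviousAVC X S Y} {L n M : ℕ} (hLM : L ≤ M)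
    {U : Fin n → (Fin L → X) → S → ℝ} (hU : U ∈ A.symmetrizing L n) (φ : A.Encoder n M)
    {s₀ : Fin n → S} (hs₀ : A.FeasibleState s₀) : A.IsJammingLaw (A.cpAttack φ id U s₀) := by
  classical
  refine ⟨⟨fun s => ?_, ?_⟩, fun s hs => ?_⟩
  · refine add_nonneg ?_ ?_ <;> split_ifs
    exacts [spoofedLaw_nonneg hU _ _, le_rfl,
      Finset.sum_nonneg fun _ _ => spoofedLaw_nonneg hU _ _, le_rfl]
  · simp only [cpAttack, Finset.sum_add_distrib, Finset.sum_ite_eq', Finset.mem_univ, if_true]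
    rw [← Finset.sum_filter, Finset.sum_filter_add_sum_filter_not, sum_spoofedLaw hLM hU]
  · by_contra hcon
    refine hs ?_
    have : s ≠ s₀ := fun h => hcon (h ▸ hs₀)
    simp [cpAttack, hcon, this]

-- The contribution of `s₀` is nonnegative and is dropped, so only feasible spoofed sequences are
-- counted.
open Classical in
lemma sum_cpAttack_mul_avgErrorAt_ge {A : ObliviousAVC X S Y} {L n M : ℕ}
    {U : Fin n → (Fin L → X) → S → ℝ} (hU : U ∈ A.symmetrizing L n) (φ : A.Encoder n M)
    (s₀ : Fin n → S) (ψ : ListDecoder Y L n M) :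
    1 / (M.choose L : ℝ) * (1 / M) * ∑ i : Fin M, ∑ l : Fin L ↪o Fin M,
      ∑ s ∈ Finset.univ.filter (fun s => A.FeasibleState s),
        wordLaw U (fun i => φ.enc (l i)) s * A.errorProb φ ψ i s ≤
      ∑ s, A.cpAttack φ id U s₀ s * A.avgErrorAt φ ψ s := by
  have havg : ∀ s, A.avgErrorAt φ ψ s = 1 / (M : ℝ) * ∑ i, A.errorProb φ ψ i s := fun s => rfl
  have hsp : ∀ s, A.spoofedLaw φ id U s = (1 / (M.choose L : ℝ)) *
      ∑ l : Fin L ↪o Fin M, wordLaw U (fun i => φ.enc (l i)) s := fun s => rfl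
  have h0 : ∀ s, 0 ≤ A.avgErrorAt φ ψ s := fun s => by
    rw [havg]
    exact mul_nonneg (by positivity) (Finset.sum_nonneg fun i _ => A.errorProb_nonneg _ _ _ _)
  calc _ = ∑ s ∈ Finset.univ.filter (fun s => A.FeasibleState s),
        A.spoofedLaw φ id U s * A.avgErrorAt φ ψ s := by
        rw [Finset.sum_congr rfl fun i _ => Finset.sum_comm, Finset.sum_comm, Finset.mul_sum]
        refine Finset.sum_congr rfl fun s _ => ?_
        rw [havg, hsp, mul_mul_mul_comm, Finset.sum_mul_sum, Finset.sum_comm]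
    _ = ∑ s, (if A.FeasibleState s then A.spoofedLaw φ id U s else 0) * A.avgErrorAt φ ψ s := by
        rw [Finset.sum_filter]
        exact Finset.sum_congr rfl fun s _ => by split_ifs <;> simp
    _ ≤ _ := by
        refine Finset.sum_le_sum fun s _ => mul_le_mul_of_nonneg_right ?_ (h0 s)
        refine le_add_of_nonneg_right ?_
        split_ifs
        exacts [Finset.sum_nonneg fun _ _ => spoofedLaw_nonneg hU _ _, le_rfl]

lemma sum_mul_avgErrorAt_le_avgError {A : ObliviousAVC X S Y} {L n M : ℕ} (φ : A.Encoder n M)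
    (ψ : ListDecoder Y L n M) {q : (Fin n → S) → ℝ} (hq : A.IsJammingLaw q) :
    ∑ s, q s * A.avgErrorAt φ ψ s ≤ A.avgError φ ψ := by
  have h : ∀ s, q s * A.avgErrorAt φ ψ s ≤ q s * A.avgError φ ψ := fun s => by
    by_cases hs : q s = 0
    · simp [hs]
    · refine mul_le_mul_of_nonneg_left ?_ (hq.1.1 s)
      exact le_ciSup (f := fun s : {s : Fin n → S // A.FeasibleState s} => A.avgErrorAt φ ψ s.1)
        (Set.finite_range _).bddAbove ⟨s, hq.2 s hs⟩
  refine (Finset.sum_le_sum fun s _ => h s).trans (le_of_eq ?_)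
  rw [← Finset.sum_mul, hq.1.2, one_mul]

/-- Against codes of positive rate, cp-symmetrization causes an error probability that is bounded
away from zero. -/
theorem exists_cpSymmetrization_lower_bound (A : ObliviousAVC X S Y) {L : ℕ} (hL : 1 ≤ L)
    (hLcp : (L : ℕ∞) ≤ A.Lcp) (hint : A.NoBoundarySymmetrization L) :
    ∃ c₁ : ℝ, 0 < c₁ ∧ ∀ R : ℝ, 0 < R → ∀ᶠ n : ℕ in Filter.atTop,
      ∀ (M : ℕ) (φ : A.Encoder n M), R ≤ A.rate n M →
        ∃ q : (Fin n → S) → ℝ, A.IsJammingLaw q ∧ A.IsCPSymmetrization L φ q ∧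
          ∀ ψ : ListDecoder Y L n M,
            c₁ ≤ ∑ s, q s * A.avgErrorAt φ ψ s ∧ c₁ ≤ A.avgError φ ψ := by
  classical
  obtain ⟨δ, hδ, hmargin⟩ := A.exists_symmetrizing_margin hL hLcp hint
  have hL0 : (0 : ℝ) < L := by exact_mod_cast hL
  -- Half of the constant in `choose_succ_ge_of_two_mul_le`: infeasible sequences may then cost at
  -- most half of the `(L + 1)`-subsets of `B`.
  set κ : ℝ := 1 / (2 ^ (L + 1) * (L + 1).factorial) / 2 with hκ
  have hκ0 : 0 < κ := by positivity
  have hκ1 : κ < 1 := by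
    have h1 : (1 : ℝ) ≤ 2 ^ (L + 1) * (L + 1).factorial :=
      one_le_mul_of_one_le_of_one_le (one_le_pow₀ one_le_two)
        (by exact_mod_cast Nat.one_le_iff_ne_zero.2 (Nat.factorial_ne_zero _))
    have : 1 / (2 ^ (L + 1) * ((L + 1).factorial : ℝ)) ≤ 1 := by
      rw [div_le_one (by positivity)]; exact h1
    rw [hκ]; linarith
  set D : ℝ := Fintype.card S + 1 with hD
  have hD0 : 0 < D := by positivity
  -- The deviation bound has the terms `1 / (θ * n)`, at most `2 * θ` for large `n`, and twice `θ`;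
  -- the `4` makes the total fit into `κ * δ`.
  set θ : ℝ := κ * δ / (4 * D) with hθ
  have hθ0 : 0 < θ := by positivity
  obtain ⟨α, hα, hsub⟩ := exists_subcode_small_variation X (η := θ / L) (by positivity)
  refine ⟨κ * α ^ (L + 1), by positivity, fun R hR => ?_⟩
  have hlarge : Tendsto (fun n : ℕ => Real.exp (R * Real.log 2 * n)) atTop atTop :=
    Real.tendsto_exp_atTop.comp (tendsto_natCast_atTop_atTop.const_mul_atTop
      (mul_pos hR (Real.log_pos one_lt_two)))
  -- The second condition ensures `2 * L ≤ α * M ≤ |B|`; the third gives `1 / (θ * n) ≤ 2 * θ`.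
  filter_upwards [eventually_gt_atTop 0, hlarge.eventually_ge_atTop (2 * L / α),
    tendsto_natCast_atTop_atTop.eventually_ge_atTop (1 / (2 * θ * θ))] with n hn hMn hnθ M φ hrate
  have hn0 : (0 : ℝ) < n := by exact_mod_cast hn
  have hM := hMn.trans (exp_le_of_le_rate hR hn hrate)
  have hM0 : (0 : ℝ) < M := lt_of_lt_of_le (by positivity) hM
  obtain ⟨B, hB, hBcard, hreg⟩ := hsub (by exact_mod_cast hM0) hn φ.enc
  have hB0 : (0 : ℝ) < B.card := by exact_mod_cast hB.card_pos
  have : Nonempty B := hB.to_subtype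
  have hBL : 2 * L ≤ B.card := by
    rw [div_le_iff₀ hα] at hM
    have : (2 : ℝ) * L ≤ B.card := by linarith
    exact_mod_cast this
  have hLM : L ≤ M := by
    have := Finset.card_le_univ B
    rw [Fintype.card_fin] at this
    omega
  -- The time-sharing alphabet is the set of positions, with the identity as time-sharing sequence,
  -- so each position has its own kernel.
  obtain ⟨U, hU, hUm⟩ := hmargin n (fun _ => (n : ℝ)⁻¹)
    (fun j => letterFreq fun i : B => φ.enc i j)
    ⟨fun _ => by positivity, by simp [hn0.ne']⟩ (fun j => letterFreq_mem_stdSimplex _)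
    (A.sum_letterFreq_mem_inputSet φ hB)
  have hbad := sum_infeasible_wordLaw_le hn φ hB hθ0 hδ hreg hU hUm
  have hfac : Fintype.card S * (1 / (θ * n) + θ + L * (θ / L)) / δ ≤ κ := by
    have e1 : L * (θ / L) = θ := by field_simp
    have e2 : 1 / (θ * n) ≤ 2 * θ := by
      rw [div_le_iff₀ (by positivity)] at hnθ ⊢
      linarith
    rw [e1, div_le_iff₀ hδ]
    calc Fintype.card S * (1 / (θ * n) + θ + θ) ≤ D * (2 * θ + θ + θ) := by
          gcongr
          rw [hD]; linarith
      _ = κ * δ := by rw [hθ]; field_simp; ring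
  replace hbad := hbad.trans (mul_le_mul_of_nonneg_right hfac (by positivity))
  -- Were no sequence feasible, the infeasible mass would be `1`, not at most `κ < 1`.
  obtain ⟨s₀, hs₀⟩ : ∃ s₀ : Fin n → S, A.FeasibleState s₀ := by
    by_contra! hcon
    simp only [hcon, not_false_eq_true, Finset.filter_true, sum_wordLaw hU] at hbad
    simp only [Finset.sum_const, Finset.card_univ, Fintype.card_fun, Fintype.card_coe,
      Fintype.card_fin, nsmul_eq_mul, mul_one, Nat.cast_pow] at hbad
    have : (0 : ℝ) < (B.card : ℝ) ^ L := by positivity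
    nlinarith
  have hq := isJammingLaw_cpAttack hLM hU φ hs₀
  refine ⟨A.cpAttack φ id U s₀, hq, ⟨n, id, U, hU, s₀, hs₀, fun s => rfl⟩, fun ψ => ?_⟩
  suffices h : κ * α ^ (L + 1) ≤ ∑ s, A.cpAttack φ id U s₀ s * A.avgErrorAt φ ψ s from
    ⟨h, h.trans (sum_mul_avgErrorAt_le_avgError φ ψ hq)⟩
  refine le_trans ?_ (sum_cpAttack_mul_avgErrorAt_ge hU φ s₀ ψ)
  have h1 := choose_sub_le_sum_wordLaw_mul_errorProb hU φ ψ B hbad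
  have h2 : κ * (α * M) ^ (L + 1) ≤ (B.card.choose (L + 1) : ℝ) - κ * (B.card : ℝ) ^ (L + 1) := by
    have h3 := choose_succ_ge_of_two_mul_le hBL
    have h4 : (B.card : ℝ) ^ (L + 1) / (2 ^ (L + 1) * (L + 1).factorial) =
        2 * κ * (B.card : ℝ) ^ (L + 1) := by rw [hκ]; ring
    have h5 : κ * (α * M) ^ (L + 1) ≤ κ * (B.card : ℝ) ^ (L + 1) := by gcongr
    linarith
  have h6 : (M.choose L : ℝ) ≤ (M : ℝ) ^ L := by exact_mod_cast Nat.choose_le_pow M L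
  have h7 : (0 : ℝ) < M.choose L := by exact_mod_cast Nat.choose_pos hLM
  -- The factor `M ^ (L + 1)` cancels against the number of choices of the sent message and the
  -- spoofed set, which is at most `M * M ^ L`.
  calc κ * α ^ (L + 1) = 1 / (M : ℝ) ^ L * (1 / M) * (κ * (α * M) ^ (L + 1)) := by
        field_simp
        ring
    _ ≤ 1 / (M.choose L : ℝ) * (1 / M) * (κ * (α * M) ^ (L + 1)) := by gcongr
    _ ≤ _ := by
        gcongr
        exact h2.trans h1

end ObliviousAVC

end

theorem mainTheorem1 {X S Y : Type*} [Fintype X] [Fintype S] [Fintype Y]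
    [DecidableEq X] [DecidableEq S] (A : ObliviousAVC X S Y) (L : ℕ) (hL : 1 ≤ L)
    (hLcp : (L : ℕ∞) ≤ A.Lcp) (hint : A.NoBoundarySymmetrization L) :
    A.capacity L = 0 ∧
      ∃ c₁ : ℝ, 0 < c₁ ∧ ∀ R : ℝ, 0 < R → ∀ᶠ n : ℕ in Filter.atTop,
        ∀ (M : ℕ) (φ : A.Encoder n M), R ≤ A.rate n M →
          ∃ q : (Fin n → S) → ℝ, A.IsJammingLaw q ∧ A.IsCPSymmetrization L φ q ∧
            ∀ ψ : ListDecoder Y L n M,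
              c₁ ≤ ∑ s, q s * A.avgErrorAt φ ψ s ∧ c₁ ≤ A.avgError φ ψ := by
  have hmain := A.exists_cpSymmetrization_lower_bound hL hLcp hint
  refine ⟨?_, hmain⟩
  obtain ⟨c₁, hc₁, h⟩ := hmain
  refine le_antisymm (iSup₂_le fun R hR => ?_) zero_le
  rw [nonpos_iff_eq_zero, ENNReal.ofReal_eq_zero]
  by_contra! hRpos
  obtain ⟨n, M, φ, ψ, hmono, hrate, hlim⟩ := hR
  have h1 := hmono.tendsto_atTop.eventually (h R hRpos)
  obtain ⟨t, ht, hsmall⟩ := (h1.and (hlim.eventually_lt_const hc₁)).exists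
  obtain ⟨q, -, -, hq⟩ := ht (M t) (φ t) (hrate t).2.2
  exact absurd (hq (ψ t)).2 (not_le.2 hsmall)
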